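/- **Setting.** Let $H\in C^\infty([-1,1])$ be even with $H(0)=1=\max H$, $H(\pm1)=0$, $H>0$ on $(-1,1)$, and $H''(0)<0<H''(1)$. Put $k=\frac1\pi\sqrt{|H''(0)|\,H''(1)}$, $\kappa=1/k$, $\mathrm S=[-\kappa,\kappa]$, and let $T>0$. For $\varepsilon>0$ let $g_\varepsilon=Z_\varepsilon^{-1}e^{-H/\varepsilon}$ with $Z_\varepsilon=\int_{-1}^1e^{-H/\varepsilon}\,d\xi$, let $\gamma_\varepsilon=g_\varepsilon\,d\xi$ on $[-1,1]$, $\tau_\varepsilon=\frac1{2\kappa}\int_{-1}^1\frac{d\xi}{g_\varepsilon(\xi)}$, $\hat s_\varepsilon(\xi)=\int_0^\xi\frac{d\eta}{\tau_\varepsilon g_\varepsilon(\eta)}$ (a bijection $[-1,1]\to\mathrm S$), and let $\hat\gamma_\varepsilon=(\hat s_\varepsilon)_\#\gamma_\varepsilon$ be the push-forward. **Functionals.** Use the conventions $0\log0=0$, $0^2/0=0$, and $w^2/0=+\infty$ for $w\neq0$. * For $u\ge0$ on $\mathrm S$: $\hat{\mathcal E}_\varepsilon(u)=\int_{\mathrm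 S}u\log u\,d\hat\gamma_\varepsilon-m\log m$ with $m=\int_{\mathrm S}u\,d\hat\gamma_\varepsilon$. For numbers $u^\pm\ge0$: $\mathcal E_0(u^\pm)=\frac12(u^+\log u^++u^-\log u^-)-m\log m$ with $m=\frac12(u^++u^-)$. * For $0\le\hat u\in C^1([0,T]\times\mathrm S)$: $$\hat{\mathcal J}_\varepsilon(\hat u)=\int_0^T\Big(\frac12\int_{\mathrm S}\frac{\hat w^2}{\hat u}\,ds+2\int_{\mathrm S}|\partial_s\sqrt{\hat u}|^2\,ds\Big)dt\in[0,\infty],$$ where $\hat w\in L^1((0,T)\times\mathrm S)$ is the (unique) solution of $\partial_t(\hat u\hat\gamma_\varepsilon)+\partial_s\hat w=0$ in $\mathcal D'((0,T)\times\mathbb R)$, with $\hat u\hat\gamma_\varepsilon$ and $\hat w$ extended by $0$ outside $\mathrm S$; $\hat{\mathcal J}_\varepsilon(\hat u)=+\infty$ if there is no such $\hat w$. * For $w\in\mathbb R$, $u^\pm\ge0$: $$M(w;u^\pm)=\inf\Big\{\int_{-\kappa}^{\kappa}\frac{w^2}{2u}+\frac{(u')^2}{2u}\,ds:\ 0\le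 u\in H^1(-\kappa,\kappa),\ u(\pm\kappa)=u^\pm\Big\}\in[0,\infty].$$ * For $u^\pm:[0,T]\to\mathbb R$: $\mathcal J_0(u^\pm)=\int_0^TM(w(t);u^\pm(t))\,dt$ with $w=\frac12\dot u^-=-\frac12\dot u^+$ if $u^\pm$ are absolutely continuous and nonnegative with $\dot u^-=-\dot u^+$ a.e.; otherwise $\mathcal J_0(u^\pm)=+\infty$. **Theorem (recovery sequence).** Let $u^\pm$ be absolutely continuous on $[0,T]$ with $\mathcal J_0(u^\pm)<\infty$. Then there is a family $(\hat u_\varepsilon)_{\varepsilon>0}$ of nonnegative functions $\hat u_\varepsilon\in C^1([0,T]\times\mathrm S)$ such that, as $\varepsilon\downarrow0$, $$\hat u_\varepsilon(\cdot,\pm\kappa)\to u^\pm\ \text{ in }L^1(0,T),\qquad \hat{\mathcal E}_\varepsilon(\hat u_\varepsilon(0))\to\mathcal E_0(u^\pm(0)),\qquad \hat{\mathcal E}_\varepsilon(\hat u_\varepsilon(T))\to\mathcal E_0(u^\pm(T)),\qquad \hat{\mathcal J}_\varepsilon(\hat u_\varepsilon)\to\mathcal J_0(u^\pm).$$ -/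

import Mathlib

open MeasureTheory Set Filter Topology
open scoped ENNReal ContDiff

noncomputable section

namespace Kramers

/-- The potential on `[-1, 1]`: smooth, even, maximal at `0` with value `1`, minimal exactly at the
two wells `±1` with value `0`, and nondegenerate at `0` and `1`. -/
structure IsDoubleWell (H : ℝ → ℝ) : Prop where
  smooth : ContDiffOn ℝ ∞ H (Icc (-1) 1)
  even : ∀ ξ ∈ Icc (-1 : ℝ) 1, H (-ξ) = H ξ
  at_zero : H 0 = 1
  at_one : H 1 = 0
  le_one : ∀ ξ ∈ Icc (-1 : ℝ) 1, H ξ ≤ 1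
  pos : ∀ ξ ∈ Ioo (-1 : ℝ) 1, 0 < H ξ
  curv_zero : iteratedDerivWithin 2 H (Icc (-1) 1) 0 < 0
  curv_one : 0 < iteratedDerivWithin 2 H (Icc (-1) 1) 1

/-- The reaction rate `k = √(|H''(0)| H''(1)) / π`. -/
def rate (H : ℝ → ℝ) : ℝ :=
  Real.sqrt (|iteratedDerivWithin 2 H (Icc (-1) 1) 0| * iteratedDerivWithin 2 H (Icc (-1) 1) 1)
    / Real.pi

/-- The half-length `κ = 1 / k` of the rescaled interval `S = [-κ, κ]`. -/
def kappa (H : ℝ → ℝ) : ℝ := 1 / rate H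

/-- The normalisation constant `Z_ε` of the stationary measure. -/
def partitionFn (H : ℝ → ℝ) (ε : ℝ) : ℝ := ∫ ξ in (-1 : ℝ)..1, Real.exp (-(H ξ) / ε)

/-- The Lebesgue density `g_ε` of `γ_ε`. -/
def gDensity (H : ℝ → ℝ) (ε ξ : ℝ) : ℝ := (partitionFn H ε)⁻¹ * Real.exp (-(H ξ) / ε)

/-- The stationary probability measure `γ_ε = g_ε 𝓛¹` on `[-1, 1]`. -/
def gammaMeasure (H : ℝ → ℝ) (ε : ℝ) : Measure ℝ :=
  (volume.restrict (Icc (-1) 1)).withDensity fun ξ => ENNReal.ofReal (gDensity H ε ξ)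

/-- The time scale `τ_ε = (2κ)⁻¹ ∫_{-1}^{1} dξ / g_ε(ξ)`. -/
def tau (H : ℝ → ℝ) (ε : ℝ) : ℝ :=
  1 / (2 * kappa H) * ∫ ξ in (-1 : ℝ)..1, 1 / gDensity H ε ξ

/-- The rescaling of space `ŝ_ε : [-1, 1] → [-κ, κ]`. -/
def sHat (H : ℝ → ℝ) (ε ξ : ℝ) : ℝ := ∫ η in (0 : ℝ)..ξ, 1 / (tau H ε * gDensity H ε η)

/-- The rescaled stationary measure, the push-forward of `γ_ε` under `ŝ_ε`. -/
def gammaHat (H : ℝ → ℝ) (ε : ℝ) : Measure ℝ := (gammaMeasure H ε).map (sHat H ε)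

/-- The free energy `∫ u log u dγ̂_ε - m log m`, with `m = ∫ u dγ̂_ε`, of the measure `u γ̂_ε`
(recall that `Real.log 0 = 0`, so that `0 log 0 = 0`). -/
def energyHat (H : ℝ → ℝ) (ε : ℝ) (u : ℝ → ℝ) : ℝ :=
  (∫ s, u s * Real.log (u s) ∂gammaHat H ε)
    - (∫ s, u s ∂gammaHat H ε) * Real.log (∫ s, u s ∂gammaHat H ε)

/-- The limit energy of the measure `½ u⁻ δ₋ + ½ u⁺ δ₊`. -/
def energyZero (um up : ℝ) : ℝ :=
  (up * Real.log up + um * Real.log um) / 2 - (um + up) / 2 * Real.log ((um + up) / 2)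

/-- The quotient `w² / u` in `[0, ∞]` for `u ≥ 0`, with `0² / 0 = 0` and `w² / 0 = ∞` if `w ≠ 0`. -/
def sqDiv (w u : ℝ) : ℝ≥0∞ := ENNReal.ofReal (w ^ 2) / ENNReal.ofReal u

/-- The pair `(ρ̂, ŵ 𝓛²)` with `ρ̂(t) = û(t, ·) γ̂` is an admissible solution of the continuity equation
`∂ₜ ρ̂ + ∂ₛ ŵ = 0` in `𝒟'((0,T) × ℝ)`, with `ρ̂` and `ŵ` extended by zero outside `[-κ, κ]`. The test
functions need not vanish at `s = ±κ`, so there is no flux through the end points. -/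
structure ContinuityEquation (κ T : ℝ) (γ : Measure ℝ) (u w : ℝ → ℝ → ℝ) : Prop where
  nonneg : ∀ t ∈ Icc 0 T, ∀ s ∈ Icc (-κ) κ, 0 ≤ u t s
  integrable_density : ∀ t ∈ Icc 0 T, Integrable (u t) γ
  weakly_continuous : ∀ φ : ℝ → ℝ, Continuous φ →
    ContinuousOn (fun t => ∫ s in Icc (-κ) κ, φ s * u t s ∂γ) (Icc 0 T)
  integrable_flux : IntegrableOn (Function.uncurry w) (Icc 0 T ×ˢ Icc (-κ) κ)
  weak_eq : ∀ φ : ℝ × ℝ → ℝ, ContDiff ℝ ∞ φ → HasCompactSupport φ →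
    tsupport φ ⊆ Ioo 0 T ×ˢ (univ : Set ℝ) →
    (∫ t in Icc 0 T, ∫ s in Icc (-κ) κ, deriv (fun r => φ (r, s)) t * u t s ∂γ)
      + (∫ t in Icc 0 T, ∫ s in Icc (-κ) κ, deriv (fun r => φ (t, r)) s * w t s) = 0

/-- The rescaled dissipation functional
`Ĵ_ε = ∫₀ᵀ (½ ∫_S ŵ² / û ds + 2 ∫_S |∂ₛ √û|² ds) dt` of the curve `t ↦ û(t, ·) γ̂_ε`, where `û` is `C¹`
on `[0, T] × S` and `ŵ` is the flux of the continuity equation. The flux is unique up to null sets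
if it exists, so that the infimum is the value at the flux, and it is `∞` if there is none.

For a nonnegative `C¹` function `û` the classical derivative of `√û` (whose default value is `0`)
agrees almost everywhere with the weak one. -/
def dissipationHat (H : ℝ → ℝ) (T ε : ℝ) (u : ℝ → ℝ → ℝ) : ℝ≥0∞ :=
  ⨅ (w : ℝ → ℝ → ℝ) (_ : ContinuityEquation (kappa H) T (gammaHat H ε) u w),
    ∫⁻ t in Icc 0 T,
      (2⁻¹ * (∫⁻ s in Icc (-kappa H) (kappa H), sqDiv (w t s) (u t s))
        + 2 * ∫⁻ s in Icc (-kappa H) (kappa H),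
            ENNReal.ofReal ((deriv (fun r => Real.sqrt (u t r)) s) ^ 2))

/-- `u` is (the continuous representative of) an element of `H¹(-κ, κ)`. -/
def IsH1 (κ : ℝ) (u : ℝ → ℝ) : Prop :=
  AbsolutelyContinuousOnInterval u (-κ) κ ∧ MemLp (deriv u) 2 (volume.restrict (Icc (-κ) κ))

/-- The function `M(w, u^±)`: the infimum of `∫_{-κ}^{κ} (w² / (2 u) + u'² / (2 u)) ds` over all
nonnegative `u ∈ H¹(-κ, κ)` with `u(±κ) = u^±`. -/
def M (κ w um up : ℝ) : ℝ≥0∞ :=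
  ⨅ (u : ℝ → ℝ) (_ : IsH1 κ u ∧ (∀ s ∈ Icc (-κ) κ, 0 ≤ u s) ∧ u (-κ) = um ∧ u κ = up),
    ∫⁻ s in Icc (-κ) κ, (sqDiv w (u s) / 2 + sqDiv (deriv u s) (u s) / 2)

open Classical in
/-- The limit functional `J₀(u^±) = ∫₀ᵀ M(w(t), u^±(t)) dt` with `w = ½ u̇⁻ = -½ u̇⁺`; it is `∞` unless
`u^±` are nonnegative and absolutely continuous with `u̇⁻ = -u̇⁺`. -/
def dissipationZero (H : ℝ → ℝ) (T : ℝ) (um up : ℝ → ℝ) : ℝ≥0∞ :=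
  if AbsolutelyContinuousOnInterval um 0 T ∧ AbsolutelyContinuousOnInterval up 0 T ∧
      (∀ t ∈ Icc 0 T, 0 ≤ um t ∧ 0 ≤ up t) ∧
      (∀ᵐ t ∂(volume.restrict (Icc 0 T)), deriv um t = -deriv up t)
  then ∫⁻ t in Icc 0 T, M (kappa H) (deriv um t / 2) (um t) (up t)
  else ∞

end Kramers

end

/-!
Along a minimiser of `M(w; u⁻, u⁺)` the first integral of the Euler–Lagrange equation makes `u` a
quadratic polynomial. Its optimality follows by calibration: the cost `w² / u` is the supremum of
its affine minorants `2 w ψ - u ψ²`, and integrating the minorants with the slopes of the quadratic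
profile bounds the cost of every competitor from below.

A path `u^±` with finite cost thus amounts to its half-difference `b = ½ (u⁺ - u⁻)` and the
coefficient `ρ` of the quadratic part, as the mean `m` of `u^±` is constant. Extend both to `ℝ`,
with `b` at rest outside `[0, T]`, and mollify in time. The cost is jointly convex, so by Jensen's
inequality mollification does not increase it, while Fatou's lemma bounds the limit from below;
adding the mollification radius to `m` keeps the profiles strictly positive.

For smooth `b` and `ρ`, correct the profile by a function of time so that its mean under `γ̂_ε` is
constant; the flux is then a primitive, with respect to `γ̂_ε`, of the time derivative. By Laplace's
method `γ̂_ε` converges to `½ δ_{-κ} + ½ δ_κ`, hence the flux tends to `½ ḃ` on the interior of `S`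
and the dissipation converges by dominated convergence. A diagonal argument lets the mollification
radius tend to zero with `ε`.
-/

namespace Kramers

section SqDiv

variable {α ι : Type*} [MeasurableSpace α] {μ : Measure α} {l : Filter ι}

theorem sqDiv_of_pos (w : ℝ) {u : ℝ} (hu : 0 < u) : sqDiv w u = ENNReal.ofReal (w ^ 2 / u) := by
  rw [sqDiv, ENNReal.ofReal_div_of_pos hu]

theorem sqDiv_zero_left (u : ℝ) : sqDiv 0 u = 0 := by
  simp [sqDiv]

theorem sqDiv_zero_right {w : ℝ} (hw : w ≠ 0) : sqDiv w 0 = ⊤ := by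
  have : ENNReal.ofReal (w ^ 2) ≠ 0 := by simpa using hw
  simp [sqDiv, ENNReal.div_zero, this]

theorem sqDiv_neg (w u : ℝ) : sqDiv (-w) u = sqDiv w u := by
  simp [sqDiv]

theorem sqDiv_anti (w : ℝ) : Antitone (sqDiv w) := fun _ _ h =>
  ENNReal.div_le_div_left (ENNReal.ofReal_le_ofReal h) _

@[fun_prop]
theorem measurable_sqDiv {w u : α → ℝ} (hw : Measurable w) (hu : Measurable u) :
    Measurable fun x => sqDiv (w x) (u x) := by
  unfold sqDiv
  fun_prop

theorem ofReal_affine_le_sqDiv {u : ℝ} (hu : 0 ≤ u) (w ψ : ℝ) :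
    ENNReal.ofReal (2 * w * ψ - u * ψ ^ 2) ≤ sqDiv w u := by
  rcases hu.eq_or_lt with rfl | hu
  · rcases eq_or_ne w 0 with rfl | hw
    · simp
    · simp [sqDiv_zero_right hw]
  · rw [sqDiv_of_pos w hu]
    apply ENNReal.ofReal_le_ofReal
    rw [le_div_iff₀ hu]
    nlinarith [sq_nonneg (w - u * ψ)]

/-- Together with `ofReal_affine_le_sqDiv`: `w² / u` is the supremum of its affine minorants, even
at `u = 0`. Convexity, Jensen's inequality and lower semicontinuity all follow from this. -/
theorem sqDiv_le_of_forall_affine_le {u : ℝ} (hu : 0 ≤ u) (w : ℝ) {X : ℝ≥0∞}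
    (hX : ∀ ψ : ℝ, ENNReal.ofReal (2 * w * ψ - u * ψ ^ 2) ≤ X) : sqDiv w u ≤ X := by
  rcases hu.eq_or_lt with rfl | hu
  · rcases eq_or_ne w 0 with rfl | hw
    · simp [sqDiv_zero_left]
    · suffices X = ⊤ by simp [this]
      refine ENNReal.eq_top_of_forall_nnreal_le fun r => ?_
      have hr : 2 * w * (r / (2 * w)) - 0 * (r / (2 * w)) ^ 2 = (r : ℝ) := by field_simp; ring
      simpa only [hr, ENNReal.ofReal_coe_nnreal] using hX (r / (2 * w))
  · rw [sqDiv_of_pos w hu]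
    convert hX (w / u) using 2
    field_simp
    ring

theorem sqDiv_le_liminf [l.NeBot] {w u : ι → ℝ} {w₀ u₀ : ℝ} (hw : Tendsto w l (𝓝 w₀))
    (hu : Tendsto u l (𝓝 u₀)) (hu0 : ∀ i, 0 ≤ u i) :
    sqDiv w₀ u₀ ≤ liminf (fun i => sqDiv (w i) (u i)) l := by
  refine sqDiv_le_of_forall_affine_le (ge_of_tendsto' hu hu0) _ fun ψ => ?_
  have hlim : Tendsto (fun i => ENNReal.ofReal (2 * w i * ψ - u i * ψ ^ 2)) l
      (𝓝 (ENNReal.ofReal (2 * w₀ * ψ - u₀ * ψ ^ 2))) :=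
    ENNReal.tendsto_ofReal (((hw.const_mul 2).mul_const ψ).sub (hu.mul_const _))
  rw [← hlim.liminf_eq]
  exact liminf_le_liminf (Eventually.of_forall fun i => ofReal_affine_le_sqDiv (hu0 i) _ _)

theorem ofReal_integral_le_lintegral_ofReal {f : α → ℝ} (hf : Integrable f μ) :
    ENNReal.ofReal (∫ x, f x ∂μ) ≤ ∫⁻ x, ENNReal.ofReal (f x) ∂μ := by
  rw [integral_eq_lintegral_pos_part_sub_lintegral_neg_part hf]
  exact (ENNReal.ofReal_le_ofReal (sub_le_self _ ENNReal.toReal_nonneg)).trans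
    ENNReal.ofReal_toReal_le

theorem sqDiv_integral_le {w u : α → ℝ} (hw : Integrable w μ) (hu : Integrable u μ)
    (hu0 : ∀ x, 0 ≤ u x) :
    sqDiv (∫ x, w x ∂μ) (∫ x, u x ∂μ) ≤ ∫⁻ x, sqDiv (w x) (u x) ∂μ := by
  refine sqDiv_le_of_forall_affine_le (integral_nonneg hu0) _ fun ψ => ?_
  have hwψ := (hw.const_mul 2).mul_const ψ
  have huψ := hu.mul_const (ψ ^ 2)
  calc ENNReal.ofReal (2 * (∫ x, w x ∂μ) * ψ - (∫ x, u x ∂μ) * ψ ^ 2)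
      = ENNReal.ofReal (∫ x, (2 * w x * ψ - u x * ψ ^ 2) ∂μ) := by
        rw [integral_sub hwψ huψ, integral_mul_const, integral_mul_const, integral_const_mul]
    _ ≤ ∫⁻ x, ENNReal.ofReal (2 * w x * ψ - u x * ψ ^ 2) ∂μ :=
        ofReal_integral_le_lintegral_ofReal (hwψ.sub huψ)
    _ ≤ ∫⁻ x, sqDiv (w x) (u x) ∂μ := lintegral_mono fun x => ofReal_affine_le_sqDiv (hu0 x) _ _

/-- The integrand `w² / (2 u) + p² / (2 u)` of `M` and of the dissipation, where `p` stands for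
`∂ₛ u`. -/
noncomputable def costDensity (w p u : ℝ) : ℝ≥0∞ := sqDiv w u / 2 + sqDiv p u / 2

theorem costDensity_eq_sqDiv (w p u : ℝ) : costDensity w p u = sqDiv √((w ^ 2 + p ^ 2) / 2) u := by
  rw [costDensity, sqDiv, sqDiv, sqDiv, Real.sq_sqrt (by positivity),
    ENNReal.ofReal_div_of_pos two_pos, ENNReal.ofReal_add (sq_nonneg w) (sq_nonneg p),
    ENNReal.ofReal_ofNat]
  simp only [div_eq_mul_inv]
  ring

theorem costDensity_of_pos (w p : ℝ) {u : ℝ} (hu : 0 < u) :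
    costDensity w p u = ENNReal.ofReal ((w ^ 2 + p ^ 2) / (2 * u)) := by
  rw [costDensity_eq_sqDiv, sqDiv_of_pos _ hu, Real.sq_sqrt (by positivity), div_div]

theorem costDensity_neg (w p u : ℝ) : costDensity (-w) p u = costDensity w p u := by
  rw [costDensity, sqDiv_neg, costDensity]

theorem costDensity_anti (w p : ℝ) : Antitone (costDensity w p) := fun _ _ h => by
  simpa only [costDensity_eq_sqDiv] using sqDiv_anti _ h

@[fun_prop]
theorem measurable_costDensity {w p u : α → ℝ} (hw : Measurable w) (hp : Measurable p)
    (hu : Measurable u) : Measurable fun x => costDensity (w x) (p x) (u x) := by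
  unfold costDensity
  fun_prop

theorem ofReal_affine_le_costDensity {u : ℝ} (hu : 0 ≤ u) (w p ψ φ : ℝ) :
    ENNReal.ofReal (w * ψ + p * φ - u * ((ψ ^ 2 + φ ^ 2) / 2)) ≤ costDensity w p u := by
  calc ENNReal.ofReal (w * ψ + p * φ - u * ((ψ ^ 2 + φ ^ 2) / 2))
      = ENNReal.ofReal ((2 * w * ψ - u * ψ ^ 2) / 2 + (2 * p * φ - u * φ ^ 2) / 2) := by
        congr 1
        ring
    _ ≤ ENNReal.ofReal (2 * w * ψ - u * ψ ^ 2) / 2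
        + ENNReal.ofReal (2 * p * φ - u * φ ^ 2) / 2 := by
        refine ENNReal.ofReal_add_le.trans_eq ?_
        rw [ENNReal.ofReal_div_of_pos two_pos, ENNReal.ofReal_div_of_pos two_pos,
          ENNReal.ofReal_ofNat]
    _ ≤ costDensity w p u := add_le_add
        (ENNReal.div_le_div_right (ofReal_affine_le_sqDiv hu _ _) _)
        (ENNReal.div_le_div_right (ofReal_affine_le_sqDiv hu _ _) _)

theorem costDensity_le_liminf [l.NeBot] {w p u : ι → ℝ} {w₀ p₀ u₀ : ℝ} (hw : Tendsto w l (𝓝 w₀))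
    (hp : Tendsto p l (𝓝 p₀)) (hu : Tendsto u l (𝓝 u₀)) (hu0 : ∀ i, 0 ≤ u i) :
    costDensity w₀ p₀ u₀ ≤ liminf (fun i => costDensity (w i) (p i) (u i)) l := by
  simp only [costDensity_eq_sqDiv]
  exact sqDiv_le_liminf (((hw.pow 2).add (hp.pow 2)).div_const 2).sqrt hu hu0

theorem tendsto_costDensity {w p u : ι → ℝ} {w₀ p₀ u₀ : ℝ} (hw : Tendsto w l (𝓝 w₀))
    (hp : Tendsto p l (𝓝 p₀)) (hu : Tendsto u l (𝓝 u₀)) (hu0 : ∀ᶠ i in l, 0 < u i)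
    (hu₀ : 0 < u₀) :
    Tendsto (fun i => costDensity (w i) (p i) (u i)) l (𝓝 (costDensity w₀ p₀ u₀)) := by
  rw [costDensity_of_pos _ _ hu₀]
  refine Tendsto.congr' (hu0.mono fun i hi => (costDensity_of_pos _ _ hi).symm)
    (ENNReal.tendsto_ofReal ?_)
  exact ((hw.pow 2).add (hp.pow 2)).div (hu.const_mul 2) (by positivity)

theorem costDensity_integral_le {w p u : α → ℝ} (hw : Integrable w μ) (hp : Integrable p μ)
    (hu : Integrable u μ) (hu0 : ∀ x, 0 ≤ u x) :
    costDensity (∫ x, w x ∂μ) (∫ x, p x ∂μ) (∫ x, u x ∂μ)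
      ≤ ∫⁻ x, costDensity (w x) (p x) (u x) ∂μ := by
  have half (f : α → ℝ≥0∞) : (∫⁻ x, f x ∂μ) / 2 = ∫⁻ x, f x / 2 ∂μ := by
    simp only [div_eq_mul_inv]
    rw [lintegral_mul_const' _ _ (by simp)]
  calc costDensity (∫ x, w x ∂μ) (∫ x, p x ∂μ) (∫ x, u x ∂μ)
      ≤ (∫⁻ x, sqDiv (w x) (u x) ∂μ) / 2 + (∫⁻ x, sqDiv (p x) (u x) ∂μ) / 2 := add_le_add
        (ENNReal.div_le_div_right (sqDiv_integral_le hw hu hu0) _)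
        (ENNReal.div_le_div_right (sqDiv_integral_le hp hu hu0) _)
    _ ≤ ∫⁻ x, costDensity (w x) (p x) (u x) ∂μ := by
        rw [half, half]
        exact le_lintegral_add _ _

end SqDiv

section Profile

variable {κ : ℝ}

/-- The bump `(κ² - s²) / (2κ²)`, which vanishes at `s = ±κ`. -/
noncomputable def bump (κ s : ℝ) : ℝ := (κ ^ 2 - s ^ 2) / (2 * κ ^ 2)

/-- The quadratic function of `s` with boundary values `m ± b` at `±κ` and second derivative
`-ρ / κ²`. The minimisers of `M` are of this form, and the recovery sequence is built from curves of
such profiles because they depend linearly on `(m, b, ρ)`. -/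
noncomputable def profile (κ m b ρ s : ℝ) : ℝ := m + b * (s / κ) + ρ * bump κ s

/-- The derivative of `profile` with respect to `s`. -/
noncomputable def profileSlope (κ b ρ s : ℝ) : ℝ := b / κ - ρ * s / κ ^ 2

/-- The value of the functional minimised in `M` at the flux `w` and the profile `(m, b, ρ)`. -/
noncomputable def profileCost (κ m w b ρ : ℝ) : ℝ≥0∞ :=
  ∫⁻ s in Icc (-κ) κ, costDensity w (profileSlope κ b ρ s) (profile κ m b ρ s)

theorem bump_nonneg {s : ℝ} (hs : s ∈ Icc (-κ) κ) : 0 ≤ bump κ s :=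
  div_nonneg (sub_nonneg.2 (sq_le_sq' hs.1 hs.2)) (by positivity)

theorem profile_right (hκ : 0 < κ) (m b ρ : ℝ) : profile κ m b ρ κ = m + b := by
  simp [profile, bump, hκ.ne']

theorem profile_left (hκ : 0 < κ) (m b ρ : ℝ) : profile κ m b ρ (-κ) = m - b := by
  simp [profile, bump, hκ.ne', sub_eq_add_neg]

theorem profile_mono_mean {m m' : ℝ} (h : m ≤ m') (κ b ρ s : ℝ) :
    profile κ m b ρ s ≤ profile κ m' b ρ s :=
  add_le_add_left (add_le_add_left h _) _

theorem hasDerivAt_profile (κ m b ρ s : ℝ) :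
    HasDerivAt (profile κ m b ρ) (profileSlope κ b ρ s) s := by
  have hbump := (((hasDerivAt_id' s).pow 2).const_sub (κ ^ 2)).div_const (2 * κ ^ 2)
  refine (((((hasDerivAt_id' s).div_const κ).const_mul b).const_add m).add
    (hbump.const_mul ρ)).congr_deriv ?_
  rw [profileSlope]
  simp only [Nat.cast_ofNat, Nat.add_one_sub_one, pow_one, mul_one]
  ring

theorem deriv_profile (κ m b ρ : ℝ) : deriv (profile κ m b ρ) = profileSlope κ b ρ :=
  funext fun s => (hasDerivAt_profile κ m b ρ s).deriv

theorem contDiff_profile (κ m b ρ : ℝ) : ContDiff ℝ 1 (profile κ m b ρ) := by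
  unfold profile bump
  fun_prop

@[fun_prop]
theorem continuous_profileSlope (κ b ρ : ℝ) : Continuous (profileSlope κ b ρ) := by
  unfold profileSlope
  fun_prop

theorem hasDerivAt_profileSlope (κ b ρ s : ℝ) :
    HasDerivAt (profileSlope κ b ρ) (-ρ / κ ^ 2) s := by
  refine ((((hasDerivAt_id' s).const_mul ρ).div_const (κ ^ 2)).const_sub (b / κ)).congr_deriv ?_
  ring

@[fun_prop]
theorem measurable_profile {α : Type*} [MeasurableSpace α] (κ m : ℝ) {b ρ s : α → ℝ}
    (hb : Measurable b) (hρ : Measurable ρ) (hs : Measurable s) :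
    Measurable fun x => profile κ m (b x) (ρ x) (s x) := by
  unfold profile bump
  fun_prop

@[fun_prop]
theorem measurable_profileSlope {α : Type*} [MeasurableSpace α] (κ : ℝ) {b ρ s : α → ℝ}
    (hb : Measurable b) (hρ : Measurable ρ) (hs : Measurable s) :
    Measurable fun x => profileSlope κ (b x) (ρ x) (s x) := by
  unfold profileSlope
  fun_prop

theorem tendsto_profile {ι : Type*} {l : Filter ι} {m b ρ : ι → ℝ} {m₀ b₀ ρ₀ : ℝ}
    (hm : Tendsto m l (𝓝 m₀)) (hb : Tendsto b l (𝓝 b₀)) (hρ : Tendsto ρ l (𝓝 ρ₀)) (κ s : ℝ) :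
    Tendsto (fun i => profile κ (m i) (b i) (ρ i) s) l (𝓝 (profile κ m₀ b₀ ρ₀ s)) :=
  (hm.add (hb.mul_const _)).add (hρ.mul_const _)

theorem tendsto_profileSlope {ι : Type*} {l : Filter ι} {b ρ : ι → ℝ} {b₀ ρ₀ : ℝ}
    (hb : Tendsto b l (𝓝 b₀)) (hρ : Tendsto ρ l (𝓝 ρ₀)) (κ s : ℝ) :
    Tendsto (fun i => profileSlope κ (b i) (ρ i) s) l (𝓝 (profileSlope κ b₀ ρ₀ s)) :=
  (hb.div_const _).sub ((hρ.mul_const _).div_const _)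

end Profile

section OptimalProfile

variable {κ w um up s : ℝ}

/-- The coefficient of `bump` in the minimiser of `M κ w um up`. It makes
`(∂ₛ u)² - w² = (∂ₛ² u) · 2u`, the first integral of the Euler-Lagrange equation. -/
noncomputable def optCoeff (κ w um up : ℝ) : ℝ := √(um * up + κ ^ 2 * w ^ 2) - (um + up) / 2

/-- The minimiser of `M κ w um up`. -/
noncomputable def optProfile (κ w um up : ℝ) : ℝ → ℝ :=
  profile κ ((um + up) / 2) ((up - um) / 2) (optCoeff κ w um up)

/-- The derivative of `optProfile`. -/
noncomputable def optSlope (κ w um up : ℝ) : ℝ → ℝ :=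
  profileSlope κ ((up - um) / 2) (optCoeff κ w um up)

/-- The value at `optProfile` of the functional minimised in `M κ w um up`. -/
noncomputable def optCost (κ w um up : ℝ) : ℝ≥0∞ :=
  ∫⁻ s in Icc (-κ) κ, costDensity w (optSlope κ w um up s) (optProfile κ w um up s)

@[fun_prop]
theorem continuous_optProfile (κ w um up : ℝ) : Continuous (optProfile κ w um up) :=
  (contDiff_profile _ _ _ _).continuous

@[fun_prop]
theorem continuous_optSlope (κ w um up : ℝ) : Continuous (optSlope κ w um up) :=
  continuous_profileSlope _ _ _

theorem optProfile_right (hκ : 0 < κ) (w um up : ℝ) : optProfile κ w um up κ = up := by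
  rw [optProfile, profile_right hκ]
  ring

theorem optProfile_left (hκ : 0 < κ) (w um up : ℝ) : optProfile κ w um up (-κ) = um := by
  rw [optProfile, profile_left hκ]
  ring

theorem optProfile_eq (hκ : 0 < κ) (w um up s : ℝ) :
    optProfile κ w um up s = (up * (κ + s) ^ 2 + um * (κ - s) ^ 2
      + 2 * √(um * up + κ ^ 2 * w ^ 2) * (κ ^ 2 - s ^ 2)) / (4 * κ ^ 2) := by
  rw [optProfile, profile, bump, optCoeff]
  field_simp
  ring

theorem optProfile_nonneg (hκ : 0 < κ) (w : ℝ) (hum : 0 ≤ um) (hup : 0 ≤ up)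
    (hs : s ∈ Icc (-κ) κ) : 0 ≤ optProfile κ w um up s := by
  rw [optProfile_eq hκ]
  have : 0 ≤ κ ^ 2 - s ^ 2 := sub_nonneg.2 (sq_le_sq' hs.1 hs.2)
  positivity

theorem optProfile_pos (hκ : 0 < κ) (w : ℝ) (hum : 0 < um) (hup : 0 < up)
    (hs : s ∈ Icc (-κ) κ) : 0 < optProfile κ w um up s := by
  rw [optProfile_eq hκ]
  have hbump : 0 ≤ κ ^ 2 - s ^ 2 := sub_nonneg.2 (sq_le_sq' hs.1 hs.2)
  have hwells : 0 < up * (κ + s) ^ 2 + um * (κ - s) ^ 2 := by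
    rcases hs.1.eq_or_lt with rfl | h
    · have : κ - -κ ≠ 0 := by linarith
      positivity
    · have : κ + s ≠ 0 := by linarith
      positivity
  positivity

theorem optSlope_sq (hκ : 0 < κ) (w : ℝ) (hum : 0 ≤ um) (hup : 0 ≤ up) (s : ℝ) :
    optSlope κ w um up s ^ 2
      = w ^ 2 + 2 * (-optCoeff κ w um up / κ ^ 2) * optProfile κ w um up s := by
  have hR : √(um * up + κ ^ 2 * w ^ 2) ^ 2 = um * up + κ ^ 2 * w ^ 2 := Real.sq_sqrt (by positivity)
  rw [optProfile_eq hκ, optSlope, profileSlope, optCoeff]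
  generalize √(um * up + κ ^ 2 * w ^ 2) = R at hR ⊢
  field_simp
  linear_combination 16 * κ ^ 2 * hR

/-- Integrate the affine minorants of the cost with slopes `(ψ, φ)`; the equation for `φ` turns the
lower bound into a null Lagrangian. -/
theorem ofReal_le_lintegral_costDensity_of_calibration {a b : ℝ} (hab : a ≤ b) (w : ℝ)
    {v ψ φ : ℝ → ℝ} (hv : AbsolutelyContinuousOnInterval v a b) (hv0 : ∀ s ∈ Icc a b, 0 ≤ v s)
    (hψ : ContinuousOn ψ (Icc a b)) (hφ : AbsolutelyContinuousOnInterval φ a b)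
    (hφψ : ∀ s ∈ Icc a b, HasDerivAt φ (-((ψ s ^ 2 + φ s ^ 2) / 2)) s) :
    ENNReal.ofReal ((∫ s in a..b, w * ψ s) + (v b * φ b - v a * φ a))
      ≤ ∫⁻ s in Icc a b, costDensity w (deriv v s) (v s) := by
  have hvφ := hv.fun_mul hφ
  have hwψ : IntervalIntegrable (fun s => w * ψ s) volume a b :=
    (continuousOn_const.mul hψ).intervalIntegrable_of_Icc hab
  have hint := hwψ.add hvφ.intervalIntegrable_deriv
  rw [← hvφ.integral_deriv_eq_sub,
    ← intervalIntegral.integral_add hwψ hvφ.intervalIntegrable_deriv,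
    intervalIntegral.integral_of_le hab, ← integral_Icc_eq_integral_Ioc]
  rw [intervalIntegrable_iff_integrableOn_Icc_of_le hab] at hint
  refine (ofReal_integral_le_lintegral_ofReal hint).trans
    (setLIntegral_mono_ae' measurableSet_Icc ?_)
  filter_upwards [hv.ae_differentiableAt] with s hdiff hs
  rw [uIcc_of_le hab] at hdiff
  have hderiv : deriv (fun r => v r * φ r) s
      = deriv v s * φ s + v s * -((ψ s ^ 2 + φ s ^ 2) / 2) :=
    ((hdiff hs).hasDerivAt.mul (hφψ s hs)).deriv
  refine (ENNReal.ofReal_le_ofReal (le_of_eq ?_)).trans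
    (ofReal_affine_le_costDensity (hv0 s hs) w (deriv v s) (ψ s) (φ s))
  rw [hderiv]
  ring

theorem optCost_eq_of_pos (hκ : 0 < κ) (w : ℝ) (hum : 0 < um) (hup : 0 < up) :
    optCost κ w um up = ENNReal.ofReal ((∫ s in (-κ)..κ, w * (w / optProfile κ w um up s))
      + (optSlope κ w um up κ - optSlope κ w um up (-κ))) := by
  have hle : -κ ≤ κ := by linarith
  set Q := optProfile κ w um up
  set E := -optCoeff κ w um up / κ ^ 2
  have hQpos : ∀ s ∈ Icc (-κ) κ, 0 < Q s := fun s hs => optProfile_pos hκ w hum hup hs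
  have hwQ : ContinuousOn (fun s => w * (w / Q s)) (Icc (-κ) κ) :=
    continuousOn_const.mul (continuousOn_const.div (continuous_optProfile _ _ _ _).continuousOn
      fun s hs => (hQpos s hs).ne')
  have hdensity : ∀ s ∈ Icc (-κ) κ, (w ^ 2 + optSlope κ w um up s ^ 2) / (2 * Q s)
      = w * (w / Q s) + E := fun s hs => by
    have hQ := (hQpos s hs).ne'
    have hsq : optSlope κ w um up s ^ 2 = w ^ 2 + 2 * E * Q s := optSlope_sq hκ w hum.le hup.le s
    rw [hsq]
    field_simp
    ring
  have hslope : ∫ _ in (-κ)..κ, E = optSlope κ w um up κ - optSlope κ w um up (-κ) :=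
    intervalIntegral.integral_eq_sub_of_hasDerivAt
      (fun s _ => hasDerivAt_profileSlope κ _ _ s) (by simp)
  calc optCost κ w um up
      = ∫⁻ s in Icc (-κ) κ, ENNReal.ofReal (w * (w / Q s) + E) :=
        setLIntegral_congr_fun measurableSet_Icc fun s hs => by
          rw [← hdensity s hs, costDensity_of_pos _ _ (hQpos s hs)]
    _ = ENNReal.ofReal (∫ s in (-κ)..κ, (w * (w / Q s) + E)) := by
        have hint : IntegrableOn (fun s => w * (w / Q s) + E) (Icc (-κ) κ) :=
          (hwQ.add continuousOn_const).integrableOn_Icc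
        rw [intervalIntegral.integral_of_le hle, ← integral_Icc_eq_integral_Ioc,
          ofReal_integral_eq_lintegral_ofReal hint]
        filter_upwards [ae_restrict_mem measurableSet_Icc] with s hs
        have := hQpos s hs
        rw [← hdensity s hs]
        positivity
    _ = _ := by
        rw [← hslope, intervalIntegral.integral_add (hwQ.intervalIntegrable_of_Icc hle) (by simp)]

theorem optCost_le_lintegral_of_pos (hκ : 0 < κ) (w : ℝ) (hum : 0 < um) (hup : 0 < up)
    {v : ℝ → ℝ} (hv : AbsolutelyContinuousOnInterval v (-κ) κ)
    (hv0 : ∀ s ∈ Icc (-κ) κ, 0 ≤ v s) (hvm : v (-κ) = um) (hvp : v κ = up) :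
    optCost κ w um up ≤ ∫⁻ s in Icc (-κ) κ, costDensity w (deriv v s) (v s) := by
  have hle : -κ ≤ κ := by linarith
  set Q := optProfile κ w um up
  have hQne : ∀ s ∈ Icc (-κ) κ, Q s ≠ 0 := fun s hs => (optProfile_pos hκ w hum hup hs).ne'
  have hslope : ContDiff ℝ 1 (optSlope κ w um up) := by
    unfold optSlope profileSlope
    fun_prop
  have hcal := ofReal_le_lintegral_costDensity_of_calibration hle w hv hv0
    (ψ := fun s => w / Q s) (φ := fun s => optSlope κ w um up s / Q s)
    (continuousOn_const.div (continuous_optProfile _ _ _ _).continuousOn hQne)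
    (ContDiffOn.absolutelyContinuousOnInterval <| by
      rw [uIcc_of_le hle]
      exact hslope.contDiffOn.div (contDiff_profile _ _ _ _).contDiffOn hQne)
    fun s hs => by
      refine ((hasDerivAt_profileSlope _ _ _ s).div (hasDerivAt_profile _ _ _ _ s)
        (hQne s hs)).congr_deriv ?_
      have hQ := hQne s hs
      have hsq : optSlope κ w um up s ^ 2 = w ^ 2 + 2 * (-optCoeff κ w um up / κ ^ 2) * Q s :=
        optSlope_sq hκ w hum.le hup.le s
      change (-optCoeff κ w um up / κ ^ 2 * Q s - optSlope κ w um up s * optSlope κ w um up s)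
        / Q s ^ 2 = _
      generalize -optCoeff κ w um up / κ ^ 2 = E at hsq ⊢
      field_simp
      linear_combination -hsq
  rw [hvm, hvp, show Q κ = up from optProfile_right hκ w um up,
    show Q (-κ) = um from optProfile_left hκ w um up, mul_div_cancel₀ _ hup.ne',
    mul_div_cancel₀ _ hum.ne'] at hcal
  rwa [optCost_eq_of_pos hκ w hum hup]

theorem tendsto_optCoeff {ι : Type*} {l : Filter ι} {um up : ι → ℝ} {um₀ up₀ : ℝ}
    (hum : Tendsto um l (𝓝 um₀)) (hup : Tendsto up l (𝓝 up₀)) (κ w : ℝ) :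
    Tendsto (fun i => optCoeff κ w (um i) (up i)) l (𝓝 (optCoeff κ w um₀ up₀)) :=
  ((hum.mul hup).add_const _).sqrt.sub ((hum.add hup).div_const 2)

/-- Adding `δ > 0` to a competitor makes its boundary values positive and does not increase the
cost; let `δ → 0` by Fatou's lemma. -/
theorem optCost_le_lintegral (hκ : 0 < κ) (w : ℝ) (hum : 0 ≤ um) (hup : 0 ≤ up)
    {v : ℝ → ℝ} (hv : AbsolutelyContinuousOnInterval v (-κ) κ)
    (hv0 : ∀ s ∈ Icc (-κ) κ, 0 ≤ v s) (hvm : v (-κ) = um) (hvp : v κ = up) :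
    optCost κ w um up ≤ ∫⁻ s in Icc (-κ) κ, costDensity w (deriv v s) (v s) := by
  set δ : ℕ → ℝ := fun n => 1 / ((n : ℝ) + 1)
  have hδ : ∀ n, 0 < δ n := fun n => Nat.one_div_pos_of_nat
  have hshift (x : ℝ) : Tendsto (fun n => x + δ n) atTop (𝓝 x) := by
    simpa only [add_zero] using tendsto_one_div_add_atTop_nhds_zero_nat.const_add x
  have hρ := tendsto_optCoeff (hshift um) (hshift up) κ w
  have hb := ((hshift up).sub (hshift um)).div_const 2
  have hm := ((hshift um).add (hshift up)).div_const 2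
  have hcost (n : ℕ) : optCost κ w (um + δ n) (up + δ n)
      ≤ ∫⁻ s in Icc (-κ) κ, costDensity w (deriv v s) (v s) := by
    refine (optCost_le_lintegral_of_pos hκ w (v := fun s => v s + δ n)
      (add_pos_of_nonneg_of_pos hum (hδ n)) (add_pos_of_nonneg_of_pos hup (hδ n))
      (hv.fun_add (contDiff_const.contDiffOn (n := 1)).absolutelyContinuousOnInterval)
      (fun s hs => add_nonneg (hv0 s hs) (hδ n).le) (by rw [hvm]) (by rw [hvp])).trans ?_
    simp only [deriv_add_const]
    exact lintegral_mono fun s => costDensity_anti _ _ (le_add_of_nonneg_right (hδ n).le)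
  calc optCost κ w um up
      ≤ ∫⁻ s in Icc (-κ) κ, liminf (fun n => costDensity w
          (optSlope κ w (um + δ n) (up + δ n) s) (optProfile κ w (um + δ n) (up + δ n) s)) atTop :=
        setLIntegral_mono' measurableSet_Icc fun s hs =>
          costDensity_le_liminf tendsto_const_nhds (tendsto_profileSlope hb hρ κ s)
            (tendsto_profile hm hb hρ κ s) fun n => optProfile_nonneg hκ w
              (add_nonneg hum (hδ n).le) (add_nonneg hup (hδ n).le) hs
    _ ≤ liminf (fun n => optCost κ w (um + δ n) (up + δ n)) atTop :=
        lintegral_liminf_le fun n => by fun_prop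
    _ ≤ _ := liminf_le_of_frequently_le' (Eventually.of_forall hcost).frequently

theorem M_eq_optCost (hκ : 0 < κ) (w : ℝ) (hum : 0 ≤ um) (hup : 0 ≤ up) :
    M κ w um up = optCost κ w um up := by
  have hbound : MemLp (optSlope κ w um up) 2 (volume.restrict (Icc (-κ) κ)) := by
    have hc := continuous_optSlope κ w um up
    obtain ⟨C, hC⟩ := isCompact_Icc.exists_bound_of_continuousOn (hc.continuousOn (s := Icc (-κ) κ))
    exact MemLp.of_bound hc.aestronglyMeasurable C ((ae_restrict_mem measurableSet_Icc).mono hC)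
  have hderiv : deriv (optProfile κ w um up) = optSlope κ w um up := deriv_profile _ _ _ _
  apply le_antisymm
  · refine iInf₂_le_of_le (optProfile κ w um up) ⟨⟨?_, hderiv ▸ hbound⟩,
      fun s hs => optProfile_nonneg hκ w hum hup hs, optProfile_left hκ _ _ _,
      optProfile_right hκ _ _ _⟩ ?_
    · exact (contDiff_profile _ _ _ _).contDiffOn.absolutelyContinuousOnInterval
    · rw [hderiv]
      exact le_rfl
  · exact le_iInf₂ fun v ⟨hv, hv0, hvm, hvp⟩ => optCost_le_lintegral hκ w hum hup hv.1 hv0 hvm hvp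

theorem optCost_zero_lt_top (hκ : 0 < κ) (hum : 0 ≤ um) (hup : 0 ≤ up) :
    optCost κ 0 um up < ⊤ := by
  set E := -optCoeff κ 0 um up / κ ^ 2
  have hcost : ∀ s ∈ Icc (-κ) κ,
      costDensity 0 (optSlope κ 0 um up s) (optProfile κ 0 um up s) ≤ ENNReal.ofReal |E| := by
    intro s hs
    have hsq : optSlope κ 0 um up s ^ 2 = 0 ^ 2 + 2 * E * optProfile κ 0 um up s :=
      optSlope_sq hκ 0 hum hup s
    rcases (optProfile_nonneg hκ 0 hum hup hs).eq_or_lt with h0 | hpos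
    · have : optSlope κ 0 um up s = 0 := by simpa [← h0] using hsq
      simp [costDensity, this, sqDiv_zero_left]
    · rw [costDensity_of_pos _ _ hpos, hsq]
      refine ENNReal.ofReal_le_ofReal (le_trans (le_of_eq ?_) (le_abs_self E))
      field_simp
      ring
  refine (setLIntegral_mono' measurableSet_Icc hcost).trans_lt ?_
  simp [ENNReal.mul_lt_top_iff]

end OptimalProfile

section Concentration

variable {ι : Type*} {κ : ℝ} {l : Filter ι} {γ : ι → Measure ℝ}

/-- Probability measures on `[-κ, κ]` that converge weakly to `½ δ_{-κ} + ½ δ_κ` along `l`. -/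
structure IsConcentrating (κ : ℝ) (γ : ι → Measure ℝ) (l : Filter ι) : Prop where
  isProbabilityMeasure : ∀ i, IsProbabilityMeasure (γ i)
  ae_mem : ∀ i, ∀ᵐ s ∂γ i, s ∈ Icc (-κ) κ
  tendsto_integral : ∀ f : ℝ → ℝ, Continuous f →
    Tendsto (fun i => ∫ s, f s ∂γ i) l (𝓝 ((f (-κ) + f κ) / 2))

theorem integrable_of_ae_mem_Icc {a b : ℝ} {μ : Measure ℝ} [IsFiniteMeasure μ] {f : ℝ → ℝ}
    (hμ : ∀ᵐ s ∂μ, s ∈ Icc a b) (hf : Continuous f) : Integrable f μ := by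
  rw [← Measure.restrict_eq_self_of_ae_mem hμ]
  exact hf.continuousOn.integrableOn_Icc

@[fun_prop]
theorem continuous_bump (κ : ℝ) : Continuous (bump κ) := by
  unfold bump
  fun_prop

theorem bump_pos {s : ℝ} (hs : s ∈ Ioo (-κ) κ) : 0 < bump κ s := by
  have hκ : 0 < κ := by linarith [hs.1, hs.2]
  exact div_pos (sub_pos.2 (sq_lt_sq' hs.1 hs.2)) (by positivity)

theorem exists_abs_le_add_mul_bump {e : ℝ → ℝ} (he : Continuous e) (hleft : e (-κ) = 0)
    (hright : e κ = 0) {η : ℝ} (hη : 0 < η) :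
    ∃ C, ∀ s ∈ Icc (-κ) κ, |e s| ≤ η + C * bump κ s := by
  have hK : IsCompact (Icc (-κ) κ ∩ {s | η ≤ |e s|}) :=
    isCompact_Icc.inter_right (isClosed_le continuous_const he.abs)
  have hpos : ∀ s ∈ Icc (-κ) κ ∩ {s | η ≤ |e s|}, 0 < bump κ s := by
    rintro s ⟨hs, hes⟩
    refine bump_pos ⟨hs.1.lt_of_ne ?_, hs.2.lt_of_ne ?_⟩ <;> rintro rfl
    · simp [hleft, hη.not_ge] at hes
    · simp [hright, hη.not_ge] at hes
  obtain ⟨C, hC⟩ := hK.exists_bound_of_continuousOn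
    (he.abs.continuousOn.div (continuous_bump κ).continuousOn fun s hs => (hpos s hs).ne')
  refine ⟨|C|, fun s hs => ?_⟩
  have hb : 0 ≤ |C| * bump κ s := mul_nonneg (abs_nonneg C) (bump_nonneg hs)
  rcases le_or_gt η |e s| with hes | hes
  · have hquot : |e s| / bump κ s ≤ |C| :=
      ((le_abs_self _).trans (hC s ⟨hs, hes⟩)).trans (le_abs_self C)
    linarith [(div_le_iff₀ (hpos s ⟨hs, hes⟩)).1 hquot]
  · linarith

/-- The difference `e` of a continuous function and its linear interpolation between `±κ` satisfies
`|e| ≤ η + C · bump` on `[-κ, κ]`. -/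
theorem isConcentrating_of_tendsto_integral (hκ : 0 < κ)
    (hprob : ∀ i, IsProbabilityMeasure (γ i)) (hmem : ∀ i, ∀ᵐ s ∂γ i, s ∈ Icc (-κ) κ)
    (hmean : Tendsto (fun i => ∫ s, s ∂γ i) l (𝓝 0))
    (hbump : Tendsto (fun i => ∫ s, bump κ s ∂γ i) l (𝓝 0)) : IsConcentrating κ γ l := by
  refine ⟨hprob, hmem, fun f hf => ?_⟩
  have hint (i : ι) {g : ℝ → ℝ} (hg : Continuous g) : Integrable g (γ i) :=
    integrable_of_ae_mem_Icc (hmem i) hg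
  set p : ℝ → ℝ := profile κ ((f (-κ) + f κ) / 2) ((f κ - f (-κ)) / 2) 0
  have hp : Continuous p := (contDiff_profile _ _ _ _).continuous
  have hinterp : Tendsto (fun i => ∫ s, p s ∂γ i) l (𝓝 ((f (-κ) + f κ) / 2)) := by
    have hpi (i : ι) : ∫ s, p s ∂γ i
        = (f (-κ) + f κ) / 2 + (f κ - f (-κ)) / 2 * ((∫ s, s ∂γ i) / κ) := by
      have hlin : Integrable (fun s => (f κ - f (-κ)) / 2 * (s / κ)) (γ i) :=
        hint i (by fun_prop)
      simp only [p, profile, zero_mul, add_zero]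
      rw [integral_add (integrable_const _) hlin, integral_const_mul, integral_div κ fun s => s]
      simp
    simpa [hpi] using ((hmean.div_const κ).const_mul ((f κ - f (-κ)) / 2)).const_add _
  have herror : Tendsto (fun i => ∫ s, (f s - p s) ∂γ i) l (𝓝 0) := by
    rw [Metric.tendsto_nhds]
    intro η hη
    obtain ⟨C, hC⟩ := exists_abs_le_add_mul_bump (e := fun s => f s - p s) (hf.sub hp)
      (by simp only [p]; rw [profile_left hκ]; ring)
      (by simp only [p]; rw [profile_right hκ]; ring) (half_pos hη)
    have hsmall : Tendsto (fun i => C * ∫ s, bump κ s ∂γ i) l (𝓝 0) := by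
      simpa using hbump.const_mul C
    filter_upwards [hsmall.eventually_lt_const (half_pos hη)] with i hi
    rw [Real.dist_0_eq_abs]
    have hbound : Integrable (fun s => η / 2 + C * bump κ s) (γ i) := hint i (by fun_prop)
    calc |∫ s, (f s - p s) ∂γ i| ≤ ∫ s, (η / 2 + C * bump κ s) ∂γ i :=
          norm_integral_le_of_norm_le (f := fun s => f s - p s) hbound
            ((hmem i).mono fun s hs => hC s hs)
      _ = η / 2 + C * ∫ s, bump κ s ∂γ i := by
          rw [integral_add (integrable_const _) ((hint i (continuous_bump κ)).const_mul C),
            integral_const_mul]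
          simp
      _ < η := by linarith
  have hsplit (i : ι) : ∫ s, (f s - p s) ∂γ i + ∫ s, p s ∂γ i = ∫ s, f s ∂γ i := by
    rw [integral_sub (hint i hf) (hint i hp), sub_add_cancel]
  simpa only [hsplit, zero_add] using herror.add hinterp

theorem abs_indicator_Iio_sub_le {s r : ℝ} (hs : s ∈ Ioo (-κ) κ) (hr : r ∈ Icc (-κ) κ) :
    |(Iio s).indicator 1 r - (κ - r) / (2 * κ)| ≤ (κ / (κ - s) + κ / (κ + s)) * bump κ r := by
  obtain ⟨hs₁, hs₂⟩ := hs
  obtain ⟨hr₁, hr₂⟩ := hr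
  have hκ : 0 < κ := by linarith
  have hleft : 0 ≤ κ / (κ - s) := div_nonneg hκ.le (by linarith)
  have hright : 0 ≤ κ / (κ + s) := div_nonneg hκ.le (by linarith)
  rcases lt_or_ge r s with hrs | hrs
  · have habs : (Iio s).indicator 1 r - (κ - r) / (2 * κ) = κ / (κ - r) * bump κ r := by
      have : κ - r ≠ 0 := by linarith
      simp only [indicator_of_mem (mem_Iio.2 hrs), Pi.one_apply, bump]
      field_simp
      ring
    have hmono : κ / (κ - r) ≤ κ / (κ - s) := by gcongr
    rw [habs, abs_of_nonneg (mul_nonneg (div_nonneg hκ.le (by linarith)) (bump_nonneg ⟨hr₁, hr₂⟩))]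
    exact mul_le_mul_of_nonneg_right (by linarith) (bump_nonneg ⟨hr₁, hr₂⟩)
  · have habs : (Iio s).indicator 1 r - (κ - r) / (2 * κ) = -(κ / (κ + r) * bump κ r) := by
      have : κ + r ≠ 0 := by linarith
      simp only [indicator_of_notMem (notMem_Iio.2 hrs), bump]
      field_simp
      ring
    have hmono : κ / (κ + r) ≤ κ / (κ + s) := by gcongr; linarith
    rw [habs, abs_neg,
      abs_of_nonneg (mul_nonneg (div_nonneg hκ.le (by linarith)) (bump_nonneg ⟨hr₁, hr₂⟩))]
    exact mul_le_mul_of_nonneg_right (by linarith) (bump_nonneg ⟨hr₁, hr₂⟩)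

namespace IsConcentrating

theorem integrable (h : IsConcentrating κ γ l) (i : ι) {f : ℝ → ℝ} (hf : Continuous f) :
    Integrable f (γ i) :=
  have := h.isProbabilityMeasure i
  integrable_of_ae_mem_Icc (h.ae_mem i) hf

theorem tendsto_integral_comp (h : IsConcentrating κ γ l) {X : Type*} [TopologicalSpace X]
    {G : X → ℝ → ℝ} (hG : Continuous (Function.uncurry G)) {x : ι → X} {x₀ : X}
    (hx : Tendsto x l (𝓝 x₀)) :
    Tendsto (fun i => ∫ s, G (x i) s ∂γ i) l (𝓝 ((G x₀ (-κ) + G x₀ κ) / 2)) := by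
  have hGx (y : X) : Continuous (G y) := hG.comp (Continuous.prodMk_right y)
  have hdiff : Tendsto (fun i => ∫ s, (G (x i) s - G x₀ s) ∂γ i) l (𝓝 0) := by
    rw [Metric.tendsto_nhds]
    intro η hη
    obtain ⟨V, hV, hVη⟩ := (isCompact_Icc (a := -κ) (b := κ)).mem_uniformity_of_prod
      (s := univ) (q := x₀) hG.continuousOn (mem_univ _) (Metric.dist_mem_uniformity (half_pos hη))
    rw [nhdsWithin_univ] at hV
    filter_upwards [hx hV] with i hi
    have := h.isProbabilityMeasure i
    rw [Real.dist_0_eq_abs]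
    have hclose : ∀ᵐ s ∂γ i, ‖G (x i) s - G x₀ s‖ ≤ η / 2 := by
      filter_upwards [h.ae_mem i] with s hs
      have hdist : dist (G (x i) s) (G x₀ s) < η / 2 := hVη _ hi s hs
      rw [← dist_eq_norm]
      exact hdist.le
    calc |∫ s, (G (x i) s - G x₀ s) ∂γ i| ≤ ∫ _, η / 2 ∂γ i :=
          norm_integral_le_of_norm_le (integrable_const _) hclose
      _ < η := by simpa using half_lt_self hη
  have hsplit (i : ι) :
      ∫ s, (G (x i) s - G x₀ s) ∂γ i + ∫ s, G x₀ s ∂γ i = ∫ s, G (x i) s ∂γ i := by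
    rw [integral_sub (h.integrable i (hGx _)) (h.integrable i (hGx _)), sub_add_cancel]
  simpa only [hsplit, zero_add] using hdiff.add (h.tendsto_integral _ (hGx x₀))

theorem tendsto_integral_bump (h : IsConcentrating κ γ l) :
    Tendsto (fun i => ∫ s, bump κ s ∂γ i) l (𝓝 0) := by
  simpa [bump] using h.tendsto_integral _ (continuous_bump κ)

/-- Replace the indicator of `(-∞, s)` by `r ↦ (κ - r) / (2κ)`, which takes the same values at
`±κ`. -/
theorem tendsto_setIntegral_Iio (h : IsConcentrating κ γ l) {f : ℝ → ℝ} (hf : Continuous f)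
    {s : ℝ} (hs : s ∈ Ioo (-κ) κ) :
    Tendsto (fun i => ∫ r in Iio s, f r ∂γ i) l (𝓝 (f (-κ) / 2)) := by
  have hκ : κ ≠ 0 := by linarith [hs.1, hs.2]
  set C := κ / (κ - s) + κ / (κ + s)
  have hlin : Tendsto (fun i => ∫ r, (κ - r) / (2 * κ) * f r ∂γ i) l (𝓝 (f (-κ) / 2)) := by
    have hends : ((κ - -κ) / (2 * κ) * f (-κ) + (κ - κ) / (2 * κ) * f κ) / 2 = f (-κ) / 2 := by
      field_simp
      ring
    exact hends ▸ h.tendsto_integral (fun r => (κ - r) / (2 * κ) * f r) (by fun_prop)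
  have herror : Tendsto (fun i => ∫ r, C * bump κ r * |f r| ∂γ i) l (𝓝 0) := by
    simpa [bump] using h.tendsto_integral (fun r => C * bump κ r * |f r|) (by fun_prop)
  have hdiff : Tendsto (fun i => ∫ r in Iio s, f r ∂γ i - ∫ r, (κ - r) / (2 * κ) * f r ∂γ i) l
      (𝓝 0) := by
    refine squeeze_zero_norm (fun i => ?_) herror
    rw [← integral_indicator measurableSet_Iio, ← integral_sub
      ((h.integrable i hf).indicator measurableSet_Iio) (h.integrable i (by fun_prop))]
    refine norm_integral_le_of_norm_le (h.integrable i (by fun_prop)) ?_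
    filter_upwards [h.ae_mem i] with r hr
    have hfactor : (Iio s).indicator f r - (κ - r) / (2 * κ) * f r
        = ((Iio s).indicator 1 r - (κ - r) / (2 * κ)) * f r := by
      by_cases hrs : r < s <;> simp [hrs, sub_mul]
    rw [hfactor, norm_mul, Real.norm_eq_abs, Real.norm_eq_abs]
    gcongr
    exact abs_indicator_Iio_sub_le hs hr
  simpa only [sub_add_cancel, zero_add] using hdiff.add hlin

end IsConcentrating

end Concentration

section Laplace

variable {V : ℝ → ℝ} {p q a b x₀ c ε : ℝ}

theorem measure_restrict_Icc_pos (hpq : p < q) (hV : ContinuousOn V (Icc p q))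
    (hx₀ : x₀ ∈ Icc p q) (hc : c < V x₀) : 0 < volume.restrict (Icc p q) {x | c ≤ V x} := by
  obtain ⟨U, hU, hUV⟩ := continuousOn_iff'.1 hV _ (isOpen_Ioi (a := c))
  have hx₀U : x₀ ∈ U := (hUV.subset ⟨hc, hx₀⟩).1
  have hmeet : (U ∩ Ioo p q).Nonempty :=
    mem_closure_iff.1 ((closure_Ioo hpq.ne).symm ▸ hx₀) U hU hx₀U
  refine ((hU.inter isOpen_Ioo).measure_pos volume hmeet).trans_le ?_
  rw [Measure.restrict_apply' measurableSet_Icc]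
  exact measure_mono fun x hx =>
    have hcx : V x ∈ Ioi c := (hUV.superset ⟨hx.1, Ioo_subset_Icc_self hx.2⟩).1
    ⟨mem_ofPred.2 (mem_Ioi.1 hcx).le, Ioo_subset_Icc_self hx.2⟩

theorem intervalIntegrable_exp_div (hV : ContinuousOn V (Icc p q)) (ha : a ∈ Icc p q)
    (hb : b ∈ Icc p q) (ε : ℝ) :
    IntervalIntegrable (fun x => Real.exp (V x / ε)) volume a b :=
  ((hV.div_const ε).rexp.mono (ordConnected_Icc.uIcc_subset ha hb)).intervalIntegrable

theorem tendsto_exp_neg_div_nhdsGT_zero (hc : 0 < c) :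
    Tendsto (fun ε : ℝ => Real.exp (-c / ε)) (𝓝[>] 0) (𝓝 0) := by
  have h : Tendsto (fun ε : ℝ => -c / ε) (𝓝[>] 0) atBot := by
    simpa only [div_eq_mul_inv] using
      tendsto_inv_nhdsGT_zero.const_mul_atTop_of_neg (neg_lt_zero.2 hc)
  exact Real.tendsto_exp_atBot.comp h

theorem intervalIntegral_exp_div_pos (hpq : p < q) (hV : ContinuousOn V (Icc p q)) (ε : ℝ) :
    0 < ∫ x in p..q, Real.exp (V x / ε) :=
  intervalIntegral.intervalIntegral_pos_of_pos_on
    (intervalIntegrable_exp_div hV (left_mem_Icc.2 hpq.le) (right_mem_Icc.2 hpq.le) ε)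
    (fun _ _ => Real.exp_pos _) hpq

theorem exp_mul_measureReal_le_intervalIntegral (hpq : p ≤ q) (hV : ContinuousOn V (Icc p q))
    (hε : 0 < ε) (c : ℝ) :
    Real.exp (c / ε) * (volume.restrict (Icc p q)).real {x | c ≤ V x}
      ≤ ∫ x in p..q, Real.exp (V x / ε) := by
  rw [intervalIntegral.integral_of_le hpq, ← integral_Icc_eq_integral_Ioc]
  have hint : IntegrableOn (fun x => Real.exp (V x / ε)) (Icc p q) :=
    (hV.div_const ε).rexp.integrableOn_Icc
  have hmarkov := mul_meas_ge_le_integral_of_nonneg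
    (Eventually.of_forall fun x => (Real.exp_pos (V x / ε)).le) hint (Real.exp (c / ε))
  simpa only [Real.exp_le_exp, div_le_div_iff_of_pos_right hε] using hmarkov

theorem tendsto_intervalIntegral_exp_div (hV : ContinuousOn V (Icc p q)) (hpa : p ≤ a)
    (hab : a < b) (hbq : b ≤ q) (hx₀ : x₀ ∈ Icc p q) (hVc : ∀ x ∈ Icc a b, V x ≤ c)
    (hc : c < V x₀) :
    Tendsto (fun ε => (∫ x in a..b, Real.exp (V x / ε)) / ∫ x in p..q, Real.exp (V x / ε))
      (𝓝[>] 0) (𝓝 0) := by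
  have hpq : p < q := hpa.trans_lt (hab.trans_le hbq)
  obtain ⟨c', hcc', hc'⟩ := exists_between hc
  set v := (volume.restrict (Icc p q)).real {x | c' ≤ V x}
  have hv : 0 < v :=
    ENNReal.toReal_pos (measure_restrict_Icc_pos hpq hV hx₀ hc').ne' (measure_ne_top _ _)
  have hupper : Tendsto (fun ε : ℝ => Real.exp (-(c' - c) / ε) * ((b - a) / v)) (𝓝[>] 0) (𝓝 0) := by
    simpa using (tendsto_exp_neg_div_nhdsGT_zero (sub_pos.2 hcc')).mul_const ((b - a) / v)
  refine tendsto_of_tendsto_of_tendsto_of_le_of_le' tendsto_const_nhds hupper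
    (Eventually.of_forall fun ε => div_nonneg
      (intervalIntegral.integral_nonneg hab.le fun x _ => (Real.exp_pos _).le)
      (intervalIntegral_exp_div_pos hpq hV ε).le) ?_
  filter_upwards [self_mem_nhdsWithin] with ε (hε : 0 < ε)
  have hnum : ∫ x in a..b, Real.exp (V x / ε) ≤ Real.exp (c / ε) * (b - a) := by
    calc ∫ x in a..b, Real.exp (V x / ε) ≤ ∫ _ in a..b, Real.exp (c / ε) := by
          refine intervalIntegral.integral_mono_on hab.le (intervalIntegrable_exp_div hV
            ⟨hpa, hab.le.trans hbq⟩ ⟨hpa.trans hab.le, hbq⟩ ε) (by simp) fun x hx => ?_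
          have := hVc x hx
          gcongr
      _ = Real.exp (c / ε) * (b - a) := by
          rw [intervalIntegral.integral_const, smul_eq_mul, mul_comm]
  calc (∫ x in a..b, Real.exp (V x / ε)) / ∫ x in p..q, Real.exp (V x / ε)
      ≤ Real.exp (c / ε) * (b - a) / (Real.exp (c' / ε) * v) :=
        div_le_div₀ (mul_nonneg (Real.exp_pos _).le (sub_nonneg.2 hab.le)) hnum (by positivity)
          (exp_mul_measureReal_le_intervalIntegral hpq.le hV hε c')
    _ = Real.exp (-(c' - c) / ε) * ((b - a) / v) := by
        rw [mul_div_mul_comm, ← Real.exp_sub]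
        ring_nf

end Laplace

namespace IsDoubleWell

variable {H : ℝ → ℝ} {ξ a : ℝ}

theorem kappa_pos (hH : IsDoubleWell H) : 0 < kappa H := by
  have hcurv : 0 < |iteratedDerivWithin 2 H (Icc (-1) 1) 0| := abs_pos.2 hH.curv_zero.ne
  have := hH.curv_one
  unfold kappa rate
  positivity

theorem gDensity_pos (hH : IsDoubleWell H) (ε ξ : ℝ) : 0 < gDensity H ε ξ :=
  mul_pos (inv_pos.2 (intervalIntegral_exp_div_pos (by norm_num) hH.smooth.continuousOn.neg ε))
    (Real.exp_pos _)

theorem continuousOn_gDensity (hH : IsDoubleWell H) (ε : ℝ) :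
    ContinuousOn (gDensity H ε) (Icc (-1) 1) :=
  continuousOn_const.mul (hH.smooth.continuousOn.neg.div_const ε).rexp

theorem integral_gDensity (hH : IsDoubleWell H) (ε : ℝ) :
    ∫ ξ in (-1 : ℝ)..1, gDensity H ε ξ = 1 := by
  have hpos : 0 < partitionFn H ε :=
    intervalIntegral_exp_div_pos (by norm_num) hH.smooth.continuousOn.neg ε
  simp only [gDensity, intervalIntegral.integral_const_mul]
  exact inv_mul_cancel₀ hpos.ne'

theorem integral_gammaMeasure (hH : IsDoubleWell H) (ε : ℝ) (f : ℝ → ℝ) :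
    ∫ ξ, f ξ ∂gammaMeasure H ε = ∫ ξ in (-1 : ℝ)..1, gDensity H ε ξ * f ξ := by
  rw [gammaMeasure, integral_withDensity_eq_integral_toReal_smul₀
    ((hH.continuousOn_gDensity ε).aemeasurable measurableSet_Icc).ennreal_ofReal
    (Eventually.of_forall fun _ => ENNReal.ofReal_lt_top),
    intervalIntegral.integral_of_le (by norm_num), integral_Icc_eq_integral_Ioc]
  simp only [ENNReal.toReal_ofReal (hH.gDensity_pos ε _).le, smul_eq_mul]

theorem isProbabilityMeasure_gammaMeasure (hH : IsDoubleWell H) (ε : ℝ) :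
    IsProbabilityMeasure (gammaMeasure H ε) := by
  have hone := hH.integral_gammaMeasure ε fun _ => 1
  simp only [mul_one, hH.integral_gDensity, integral_const, smul_eq_mul] at hone
  exact ⟨(ENNReal.toReal_eq_one_iff _).1 hone⟩

theorem ae_mem_gammaMeasure (H : ℝ → ℝ) (ε : ℝ) :
    ∀ᵐ ξ ∂gammaMeasure H ε, ξ ∈ Icc (-1 : ℝ) 1 :=
  (withDensity_absolutelyContinuous _ _).ae_le (ae_restrict_mem measurableSet_Icc)

theorem sHat_eq (hH : IsDoubleWell H) (ε ξ : ℝ) :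
    sHat H ε ξ = 2 * kappa H * ((∫ η in (0 : ℝ)..ξ, Real.exp (H η / ε))
      / ∫ η in (-1 : ℝ)..1, Real.exp (H η / ε)) := by
  have hZ : partitionFn H ε ≠ 0 :=
    (intervalIntegral_exp_div_pos (by norm_num) hH.smooth.continuousOn.neg ε).ne'
  have hinv (η : ℝ) : 1 / gDensity H ε η = partitionFn H ε * Real.exp (H η / ε) := by
    rw [gDensity, neg_div, Real.exp_neg, one_div, mul_inv, inv_inv, inv_inv]
  have hintegrand (η : ℝ) : 1 / (tau H ε * gDensity H ε η)
      = 2 * kappa H / (∫ η in (-1 : ℝ)..1, Real.exp (H η / ε)) * Real.exp (H η / ε) := by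
    rw [← div_div, ← mul_one_div (1 / _), hinv]
    simp only [tau, hinv, intervalIntegral.integral_const_mul]
    field_simp
  simp only [sHat, hintegrand, intervalIntegral.integral_const_mul]
  ring

theorem sHat_sub (hH : IsDoubleWell H) (ε : ℝ) {b : ℝ} (ha : a ∈ Icc (-1) 1) (hb : b ∈ Icc (-1) 1) :
    sHat H ε b - sHat H ε a = 2 * kappa H * ((∫ η in a..b, Real.exp (H η / ε))
      / ∫ η in (-1 : ℝ)..1, Real.exp (H η / ε)) := by
  have h0 : (0 : ℝ) ∈ Icc (-1) 1 := by norm_num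
  rw [hH.sHat_eq, hH.sHat_eq, ← mul_sub, ← sub_div, intervalIntegral.integral_interval_sub_left
    (intervalIntegrable_exp_div hH.smooth.continuousOn h0 hb ε)
    (intervalIntegrable_exp_div hH.smooth.continuousOn h0 ha ε)]

theorem monotoneOn_sHat (hH : IsDoubleWell H) (ε : ℝ) : MonotoneOn (sHat H ε) (Icc (-1) 1) := by
  intro a ha b hb hab
  rw [← sub_nonneg, hH.sHat_sub ε ha hb]
  have hnum : 0 ≤ ∫ η in a..b, Real.exp (H η / ε) :=
    intervalIntegral.integral_nonneg hab fun _ _ => (Real.exp_pos _).le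
  have hden := intervalIntegral_exp_div_pos (by norm_num) hH.smooth.continuousOn ε
  have := hH.kappa_pos
  positivity

theorem sHat_neg (hH : IsDoubleWell H) (ε : ℝ) (hξ : ξ ∈ Icc (-1) 1) :
    sHat H ε (-ξ) = -sHat H ε ξ := by
  have heven : ∫ η in (0 : ℝ)..(-ξ), Real.exp (H η / ε)
      = ∫ η in (0 : ℝ)..(-ξ), Real.exp (H (-η) / ε) := by
    refine intervalIntegral.integral_congr fun η hη => ?_
    have hη' : η ∈ Icc (-1 : ℝ) 1 :=
      ordConnected_Icc.uIcc_subset (by norm_num) ⟨neg_le_neg hξ.2, neg_le.1 hξ.1⟩ hη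
    simp only [hH.even η hη']
  rw [hH.sHat_eq, hH.sHat_eq, heven, intervalIntegral.integral_comp_neg fun η => Real.exp (H η / ε),
    neg_zero, neg_neg, intervalIntegral.integral_symm]
  ring

theorem sHat_one (hH : IsDoubleWell H) (ε : ℝ) : sHat H ε 1 = kappa H := by
  have hone : (1 : ℝ) ∈ Icc (-1) 1 := by norm_num
  have hlength := hH.sHat_sub ε (a := -1) (by norm_num) hone
  have hden := intervalIntegral_exp_div_pos (by norm_num) hH.smooth.continuousOn ε
  rw [hH.sHat_neg ε hone, div_self hden.ne'] at hlength
  linarith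

theorem sHat_mem (hH : IsDoubleWell H) (ε : ℝ) (hξ : ξ ∈ Icc (-1) 1) :
    sHat H ε ξ ∈ Icc (-kappa H) (kappa H) := by
  have hone : (1 : ℝ) ∈ Icc (-1) 1 := by norm_num
  rw [← hH.sHat_one ε, ← hH.sHat_neg ε hone]
  exact ⟨hH.monotoneOn_sHat ε (by norm_num) hξ hξ.1, hH.monotoneOn_sHat ε hξ hone hξ.2⟩

theorem aemeasurable_sHat (hH : IsDoubleWell H) (ε : ℝ) :
    AEMeasurable (sHat H ε) (gammaMeasure H ε) :=
  (aemeasurable_restrict_of_monotoneOn measurableSet_Icc (hH.monotoneOn_sHat ε)).mono_ac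
    (withDensity_absolutelyContinuous _ _)

theorem integral_gammaHat (hH : IsDoubleWell H) (ε : ℝ) {f : ℝ → ℝ} (hf : Continuous f) :
    ∫ s, f s ∂gammaHat H ε = ∫ ξ, f (sHat H ε ξ) ∂gammaMeasure H ε :=
  integral_map (hH.aemeasurable_sHat ε) hf.aestronglyMeasurable

theorem integral_id_gammaHat (hH : IsDoubleWell H) (ε : ℝ) : ∫ s, s ∂gammaHat H ε = 0 := by
  have hodd : ∫ ξ in (-1 : ℝ)..1, gDensity H ε ξ * sHat H ε ξ
      = ∫ ξ in (-1 : ℝ)..1, -(gDensity H ε (-ξ) * sHat H ε (-ξ)) := by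
    refine intervalIntegral.integral_congr fun ξ hξ => ?_
    rw [uIcc_of_le (by norm_num)] at hξ
    simp only [gDensity, hH.even ξ hξ, hH.sHat_neg ε hξ]
    ring
  rw [intervalIntegral.integral_neg,
    intervalIntegral.integral_comp_neg fun ξ => gDensity H ε ξ * sHat H ε ξ, neg_neg] at hodd
  rw [hH.integral_gammaHat ε (f := fun s => s) continuous_id, hH.integral_gammaMeasure]
  linarith

theorem exists_le_half_near_one (hH : IsDoubleWell H) :
    ∃ a ∈ Ioo (0 : ℝ) 1, ∀ ξ ∈ Icc a 1, H ξ ≤ 1 / 2 := by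
  have hcont : Tendsto H (𝓝[≤] 1) (𝓝 0) := by
    have h := hH.smooth.continuousOn 1 (by norm_num)
    rwa [ContinuousWithinAt, nhdsWithin_Icc_eq_nhdsLE (by norm_num), hH.at_one] at h
  obtain ⟨b, hb, hbH⟩ := (mem_nhdsLE_iff_exists_mem_Ico_Ioc_subset zero_lt_one).1
    (hcont.eventually_le_const (by norm_num : (0 : ℝ) < 1 / 2))
  refine ⟨(b + 1) / 2, ⟨by linarith [hb.1], by linarith [hb.2]⟩, fun ξ hξ => hbH ⟨?_, hξ.2⟩⟩
  linarith [hξ.1, hb.2]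

theorem tendsto_sHat (hH : IsDoubleWell H) (ha : a ∈ Ioo (0 : ℝ) 1)
    (hHa : ∀ ξ ∈ Icc a 1, H ξ ≤ 1 / 2) :
    Tendsto (fun ε => sHat H ε a) (𝓝[>] 0) (𝓝 (kappa H)) := by
  have hratio := tendsto_intervalIntegral_exp_div (x₀ := 0) hH.smooth.continuousOn
    (by linarith [ha.1]) ha.2 le_rfl (by norm_num) hHa (by norm_num [hH.at_zero])
  have hlim : Tendsto (fun ε => kappa H - 2 * kappa H * ((∫ η in a..1, Real.exp (H η / ε))
      / ∫ η in (-1 : ℝ)..1, Real.exp (H η / ε))) (𝓝[>] 0) (𝓝 (kappa H)) := by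
    simpa using (hratio.const_mul (2 * kappa H)).const_sub (kappa H)
  refine hlim.congr fun ε => ?_
  rw [← hH.sHat_sub ε ⟨by linarith [ha.1], ha.2.le⟩ (by norm_num), hH.sHat_one, sub_sub_cancel]

theorem tendsto_gammaMeasure_Icc (hH : IsDoubleWell H) (ha : a ∈ Ioo (0 : ℝ) 1) :
    Tendsto (fun ε => (gammaMeasure H ε).real (Icc (-a) a)) (𝓝[>] 0) (𝓝 0) := by
  have hsub : Icc (-a) a ⊆ Ioo (-1) 1 := Icc_subset_Ioo (by linarith [ha.2]) ha.2
  obtain ⟨ξ₀, hξ₀, hmin⟩ := isCompact_Icc.exists_isMinOn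
    (nonempty_Icc.2 (by linarith [ha.1] : -a ≤ a))
    (hH.smooth.continuousOn.mono (hsub.trans Ioo_subset_Icc_self))
  have hratio := tendsto_intervalIntegral_exp_div (p := -1) (q := 1) (x₀ := 1)
    hH.smooth.continuousOn.neg (by linarith [ha.2]) (by linarith [ha.1]) ha.2.le (by norm_num)
    (fun ξ hξ => neg_le_neg (hmin hξ)) (by simpa [hH.at_one] using hH.pos ξ₀ (hsub hξ₀))
  refine hratio.congr fun ε => ?_
  have hind : ∫ ξ in (-1 : ℝ)..1, gDensity H ε ξ * (Icc (-a) a).indicator 1 ξ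
      = ∫ ξ in -a..a, gDensity H ε ξ := by
    have hmul (ξ : ℝ) : gDensity H ε ξ * (Icc (-a) a).indicator 1 ξ
        = (Icc (-a) a).indicator (gDensity H ε) ξ := by
      by_cases hξ : ξ ∈ Icc (-a) a <;> simp [hξ]
    simp only [hmul]
    rw [intervalIntegral.integral_of_le (by norm_num), intervalIntegral.integral_of_le
      (by linarith [ha.1]), setIntegral_indicator measurableSet_Icc,
      inter_eq_right.2 (hsub.trans Ioo_subset_Ioc_self), integral_Icc_eq_integral_Ioc]
  rw [← integral_indicator_one measurableSet_Icc, hH.integral_gammaMeasure, hind]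
  simp only [gDensity, intervalIntegral.integral_const_mul]
  exact div_eq_inv_mul _ _

theorem bump_sHat_le (hH : IsDoubleWell H) (ε : ℝ) (ha : a ∈ Ioo (0 : ℝ) 1)
    (hξ : ξ ∈ Icc (-1) 1) :
    bump (kappa H) (sHat H ε ξ)
      ≤ bump (kappa H) (sHat H ε a) + 1 / 2 * (Icc (-a) a).indicator 1 ξ := by
  have hκ := hH.kappa_pos
  have ha' : a ∈ Icc (-1 : ℝ) 1 := ⟨by linarith [ha.1], ha.2.le⟩
  by_cases hξa : ξ ∈ Icc (-a) a
  · have hhalf : bump (kappa H) (sHat H ε ξ) ≤ 1 / 2 := by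
      rw [bump, div_le_div_iff₀ (by positivity) two_pos]
      linarith [sq_nonneg (sHat H ε ξ)]
    rw [indicator_of_mem hξa, Pi.one_apply, mul_one]
    linarith [bump_nonneg (hH.sHat_mem ε ha')]
  · have hmono := hH.monotoneOn_sHat ε
    have hsa : 0 ≤ sHat H ε a := by
      simpa [sHat] using hmono (by norm_num : (0 : ℝ) ∈ Icc (-1) 1) ha' ha.1.le
    have hle : sHat H ε a ≤ |sHat H ε ξ| := by
      rcases not_and_or.1 hξa with hlt | hlt
      · have h := hmono hξ (neg_mem_Icc_iff.2 (by simpa using ha')) (not_le.1 hlt).le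
        rw [hH.sHat_neg ε ha'] at h
        exact (le_neg_of_le_neg h).trans (neg_le_abs _)
      · exact (hmono ha' hξ (not_le.1 hlt).le).trans (le_abs_self _)
    rw [indicator_of_notMem hξa, mul_zero, add_zero, bump, bump]
    have hsq := sq_le_sq' (by linarith) hle
    rw [sq_abs] at hsq
    gcongr

theorem integral_bump_gammaHat_le (hH : IsDoubleWell H) (ε : ℝ) (ha : a ∈ Ioo (0 : ℝ) 1) :
    ∫ s, bump (kappa H) s ∂gammaHat H ε
      ≤ bump (kappa H) (sHat H ε a) + 1 / 2 * (gammaMeasure H ε).real (Icc (-a) a) := by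
  have := hH.isProbabilityMeasure_gammaMeasure ε
  have hind : Integrable (fun ξ => 1 / 2 * (Icc (-a) a).indicator (1 : ℝ → ℝ) ξ)
      (gammaMeasure H ε) :=
    ((integrable_const 1).indicator measurableSet_Icc).const_mul _
  calc ∫ s, bump (kappa H) s ∂gammaHat H ε
      = ∫ ξ, bump (kappa H) (sHat H ε ξ) ∂gammaMeasure H ε :=
        hH.integral_gammaHat ε (continuous_bump _)
    _ ≤ ∫ ξ, (bump (kappa H) (sHat H ε a) + 1 / 2 * (Icc (-a) a).indicator 1 ξ)
          ∂gammaMeasure H ε := by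
        refine integral_mono_of_nonneg ?_ ((integrable_const _).add hind) ?_
        · filter_upwards [ae_mem_gammaMeasure H ε] with ξ hξ using bump_nonneg (hH.sHat_mem ε hξ)
        · filter_upwards [ae_mem_gammaMeasure H ε] with ξ hξ using hH.bump_sHat_le ε ha hξ
    _ = bump (kappa H) (sHat H ε a) + 1 / 2 * (gammaMeasure H ε).real (Icc (-a) a) := by
        rw [integral_add (integrable_const _) hind, integral_const_mul,
          integral_indicator_one measurableSet_Icc]
        simp

theorem isConcentrating_gammaHat (hH : IsDoubleWell H) :
    IsConcentrating (kappa H) (gammaHat H) (𝓝[>] 0) := by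
  refine isConcentrating_of_tendsto_integral hH.kappa_pos (fun ε => ?_) (fun ε => ?_) ?_ ?_
  · have := hH.isProbabilityMeasure_gammaMeasure ε
    exact Measure.isProbabilityMeasure_map (hH.aemeasurable_sHat ε)
  · exact (ae_map_iff (hH.aemeasurable_sHat ε) measurableSet_Icc).2
      ((ae_mem_gammaMeasure H ε).mono fun ξ hξ => hH.sHat_mem ε hξ)
  · simp only [hH.integral_id_gammaHat, tendsto_const_nhds]
  · obtain ⟨a, ha, hHa⟩ := hH.exists_le_half_near_one
    have hbump : Tendsto (fun ε => bump (kappa H) (sHat H ε a)) (𝓝[>] 0) (𝓝 0) := by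
      have h := ((continuous_bump (kappa H)).tendsto _).comp (hH.tendsto_sHat ha hHa)
      have hright : bump (kappa H) (kappa H) = 0 := by simp [bump]
      rwa [hright] at h
    refine squeeze_zero (fun ε => ?_) (fun ε => hH.integral_bump_gammaHat_le ε ha)
      (by simpa only [mul_zero, add_zero] using
        hbump.add ((hH.tendsto_gammaMeasure_Icc ha).const_mul (1 / 2)))
    rw [hH.integral_gammaHat ε (continuous_bump _)]
    exact integral_nonneg_of_ae
      ((ae_mem_gammaMeasure H ε).mono fun ξ hξ => bump_nonneg (hH.sHat_mem ε hξ))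

end IsDoubleWell

section FluxUniqueness

variable {κ T : ℝ} {γ : Measure ℝ} {u : ℝ → ℝ → ℝ}

/-- `∫_{-∞}^s g(t, r) dr` is the convolution of `g(t, ·)` with the indicator of `[0, ∞)`. -/
theorem exists_contDiff_hasDerivAt_snd {g : ℝ × ℝ → ℝ} (hg : ContDiff ℝ ∞ g)
    (hgc : HasCompactSupport g) :
    ∃ G : ℝ × ℝ → ℝ, ContDiff ℝ ∞ G ∧ (∀ t s, HasDerivAt (fun r => G (t, r)) (g (t, s)) s) ∧
      ∀ t s, t ∉ Prod.fst '' tsupport g → G (t, s) = 0 := by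
  set step : ℝ → ℝ := (Ici 0).indicator 1
  have hstep : LocallyIntegrable step :=
    (locallyIntegrable_const 1).indicator measurableSet_Ici
  have hslice (t : ℝ) : ContDiff ℝ ∞ fun s => g (t, s) := hg.comp (by fun_prop)
  have hvanish (t s : ℝ) (hs : s ∉ Prod.snd '' tsupport g) : g (t, s) = 0 :=
    image_eq_zero_of_notMem_tsupport fun hmem => hs ⟨(t, s), hmem, rfl⟩
  have hslicec (t : ℝ) : HasCompactSupport fun s => g (t, s) :=
    .intro (hgc.isCompact.image continuous_snd) (hvanish t)
  set G : ℝ × ℝ → ℝ := fun q =>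
    convolution step (fun s => g (q.1, s)) (ContinuousLinearMap.lsmul ℝ ℝ) volume q.2
  refine ⟨G, ?_, fun t s => ?_, fun t s ht => ?_⟩
  · rw [← contDiffOn_univ, ← univ_prod_univ]
    exact contDiffOn_convolution_right_with_param (g := fun t s => g (t, s)) _ isOpen_univ
      (hgc.isCompact.image continuous_snd) (fun t s _ => hvanish t s) hstep hg.contDiffOn
  · refine ((hslicec t).hasDerivAt_convolution_right (ContinuousLinearMap.lsmul ℝ ℝ) hstep
      ((hslice t).of_le (by simp)) s).congr_deriv ?_
    have hreflect : ContDiff ℝ 1 fun x => g (t, s - x) :=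
      hg.of_le (by simp) |>.comp (by fun_prop)
    have hreflectc : HasCompactSupport fun x => g (t, s - x) :=
      (hslicec t).comp_homeomorph (Homeomorph.subLeft s)
    have hderiv (x : ℝ) : deriv (fun x => g (t, s - x)) x = -deriv (fun r => g (t, r)) (s - x) :=
      deriv_comp_const_sub (f := fun r => g (t, r)) s x
    have hFTC := hreflectc.integral_Ioi_deriv_eq hreflect 0
    simp only [hderiv, integral_neg, sub_zero, neg_inj] at hFTC
    simp only [convolution, step, ContinuousLinearMap.lsmul_apply, smul_eq_mul]
    rw [← hFTC, ← integral_Ici_eq_integral_Ioi, ← integral_indicator measurableSet_Ici]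
    congr 1 with x
    by_cases hx : x ∈ Ici (0 : ℝ) <;> simp [hx]
  · have hzero : (fun r => g (t, r)) = 0 :=
      funext fun r => image_eq_zero_of_notMem_tsupport fun hmem => ht ⟨(t, r), hmem, rfl⟩
    simp only [G, hzero, convolution_zero, Pi.zero_apply]

/-- A cutoff in `s` makes the primitive compactly supported without changing it on `[-κ, κ]`. -/
theorem exists_testFunction_deriv_snd_eq (κ : ℝ) {g : ℝ × ℝ → ℝ} (hg : ContDiff ℝ ∞ g)
    (hgc : HasCompactSupport g) (hgT : tsupport g ⊆ Ioo 0 T ×ˢ univ) :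
    ∃ φ : ℝ × ℝ → ℝ, ContDiff ℝ ∞ φ ∧ HasCompactSupport φ ∧
      tsupport φ ⊆ Ioo 0 T ×ˢ (univ : Set ℝ) ∧
      ∀ t, ∀ s ∈ Icc (-κ) κ, deriv (fun r => φ (t, r)) s = g (t, s) := by
  obtain ⟨G, hG, hGderiv, hGzero⟩ := exists_contDiff_hasDerivAt_snd hg hgc
  let χ : ContDiffBump (0 : ℝ) := ⟨|κ| + 1, |κ| + 2, by positivity, by linarith⟩
  set K : Set (ℝ × ℝ) := (Prod.fst '' tsupport g) ×ˢ tsupport χ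
  have hK : IsCompact K := (hgc.isCompact.image continuous_fst).prod χ.hasCompactSupport
  have hsupp (p : ℝ × ℝ) (hp : p ∉ K) : χ p.2 * G p = 0 := by
    rcases not_and_or.1 (mt mem_prod.2 hp) with ht | hs
    · rw [hGzero p.1 p.2 ht, mul_zero]
    · rw [image_eq_zero_of_notMem_tsupport hs, zero_mul]
  refine ⟨fun p => χ p.2 * G p, (χ.contDiff.comp contDiff_snd).mul hG, .intro hK hsupp, ?_,
    fun t s hs => ?_⟩
  · refine (closure_minimal (Function.support_subset_iff'.2 hsupp) hK.isClosed).trans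
      (prod_mono ?_ (subset_univ _))
    exact image_subset_iff.2 fun p hp => (hgT hp).1
  · have hχ : (fun r => χ r * G (t, r)) =ᶠ[𝓝 s] fun r => G (t, r) := by
      have hs' : s ∈ Metric.ball (0 : ℝ) χ.rIn := by
        rw [mem_ball_zero_iff, Real.norm_eq_abs]
        have : |s| ≤ |κ| := abs_le_abs hs.2 (by linarith [hs.1])
        exact this.trans_lt (lt_add_one _)
      filter_upwards [χ.eventuallyEq_one_of_mem_ball hs'] with r hr
      rw [hr, Pi.one_apply, one_mul]
    rw [hχ.deriv_eq, (hGderiv t s).deriv]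

namespace ContinuityEquation

theorem setIntegral_mul_flux_eq {w₁ w₂ : ℝ → ℝ → ℝ} (h₁ : ContinuityEquation κ T γ u w₁)
    (h₂ : ContinuityEquation κ T γ u w₂) {g : ℝ × ℝ → ℝ} (hg : ContDiff ℝ ∞ g)
    (hgc : HasCompactSupport g) (hgT : tsupport g ⊆ Ioo 0 T ×ˢ univ) :
    ∫ p in Icc 0 T ×ˢ Icc (-κ) κ, g p * w₁ p.1 p.2
      = ∫ p in Icc 0 T ×ˢ Icc (-κ) κ, g p * w₂ p.1 p.2 := by
  obtain ⟨φ, hφ, hφc, hφT, hφg⟩ := exists_testFunction_deriv_snd_eq κ hg hgc hgT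
  have hiterated {w : ℝ → ℝ → ℝ} (h : ContinuityEquation κ T γ u w) :
      ∫ p in Icc 0 T ×ˢ Icc (-κ) κ, g p * w p.1 p.2
        = ∫ t in Icc 0 T, ∫ s in Icc (-κ) κ, deriv (fun r => φ (t, r)) s * w t s := by
    obtain ⟨C, hC⟩ := hg.continuous.bounded_above_of_compact_support hgc
    have hint : IntegrableOn (fun p : ℝ × ℝ => g p * w p.1 p.2) (Icc 0 T ×ˢ Icc (-κ) κ) :=
      Integrable.bdd_mul h.integrable_flux hg.continuous.aestronglyMeasurable
        (Eventually.of_forall hC)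
    rw [Measure.volume_eq_prod] at hint ⊢
    rw [setIntegral_prod _ hint]
    refine integral_congr_ae (Eventually.of_forall fun t => ?_)
    exact setIntegral_congr_fun measurableSet_Icc fun s hs => by simp only [hφg t s hs]
  rw [hiterated h₁, hiterated h₂]
  linarith [h₁.weak_eq φ hφ hφc hφT, h₂.weak_eq φ hφ hφc hφT]

theorem flux_ae_eq {w₁ w₂ : ℝ → ℝ → ℝ} (h₁ : ContinuityEquation κ T γ u w₁)
    (h₂ : ContinuityEquation κ T γ u w₂) :
    ∀ᵐ t ∂volume.restrict (Icc 0 T), ∀ᵐ s ∂volume.restrict (Icc (-κ) κ), w₁ t s = w₂ t s := by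
  set R : Set (ℝ × ℝ) := Icc 0 T ×ˢ Icc (-κ) κ
  have hR : MeasurableSet R := measurableSet_Icc.prod measurableSet_Icc
  set D : ℝ × ℝ → ℝ := fun p => w₁ p.1 p.2 - w₂ p.1 p.2
  have hD : IntegrableOn D R := h₁.integrable_flux.sub h₂.integrable_flux
  have hinterior : ∀ᵐ p, p ∈ Ioo 0 T ×ˢ Ioo (-κ) κ → R.indicator D p = 0 := by
    refine (isOpen_Ioo.prod isOpen_Ioo).ae_eq_zero_of_integral_contDiff_smul_eq_zero
      (((integrable_indicator_iff hR).2 hD).locallyIntegrable.locallyIntegrableOn _)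
      fun g hg hgc hgU => ?_
    have hbdd := hg.continuous.bounded_above_of_compact_support hgc
    have hint {w : ℝ → ℝ → ℝ} (h : ContinuityEquation κ T γ u w) :
        IntegrableOn (fun p : ℝ × ℝ => g p * w p.1 p.2) R :=
      hbdd.elim fun C hC => Integrable.bdd_mul h.integrable_flux
        hg.continuous.aestronglyMeasurable (Eventually.of_forall hC)
    calc ∫ p, g p • R.indicator D p = ∫ p in R, (g p * w₁ p.1 p.2 - g p * w₂ p.1 p.2) := by
          rw [← integral_indicator hR]
          congr 1 with p
          by_cases hp : p ∈ R <;> simp [hp, D, mul_sub]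
      _ = 0 := by
          rw [integral_sub (hint h₁) (hint h₂), sub_eq_zero]
          exact h₁.setIntegral_mul_flux_eq h₂ hg hgc
            (hgU.trans (prod_mono_right (subset_univ _)))
  have hzero : ∀ᵐ p ∂volume.restrict R, D p = 0 := by
    rw [ae_restrict_iff' hR]
    have hRU : R =ᵐ[volume] Ioo 0 T ×ˢ Ioo (-κ) κ :=
      Measure.set_prod_ae_eq Ioo_ae_eq_Icc.symm Ioo_ae_eq_Icc.symm
    filter_upwards [hinterior, hRU.mem_iff] with p hp hpR hpmem
    simpa only [indicator_of_mem hpmem] using hp (hpR.1 hpmem)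
  rw [Measure.volume_eq_prod, ← Measure.prod_restrict] at hzero
  filter_upwards [Measure.ae_ae_of_ae_prod hzero] with t ht
  filter_upwards [ht] with s hs using sub_eq_zero.1 hs

end ContinuityEquation

/-- The functional `dissipationHat` for an arbitrary measure `γ` on `[-κ, κ]`. -/
noncomputable def dissipation (κ T : ℝ) (γ : Measure ℝ) (u : ℝ → ℝ → ℝ) : ℝ≥0∞ :=
  ⨅ (w : ℝ → ℝ → ℝ) (_ : ContinuityEquation κ T γ u w),
    ∫⁻ t in Icc 0 T,
      (2⁻¹ * (∫⁻ s in Icc (-κ) κ, sqDiv (w t s) (u t s))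
        + 2 * ∫⁻ s in Icc (-κ) κ, ENNReal.ofReal ((deriv (fun r => Real.sqrt (u t r)) s) ^ 2))

theorem two_mul_deriv_sqrt_sq {f : ℝ → ℝ} {f' s : ℝ} (hf : HasDerivAt f f' s) (hpos : 0 < f s) :
    2 * ENNReal.ofReal ((deriv (fun r => Real.sqrt (f r)) s) ^ 2) = sqDiv f' (f s) / 2 := by
  have htwo : (2 : ℝ≥0∞) = ENNReal.ofReal 2 := by simp
  rw [(hf.sqrt hpos.ne').deriv, sqDiv_of_pos _ hpos, htwo, ← ENNReal.ofReal_div_of_pos two_pos,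
    ← ENNReal.ofReal_mul two_pos.le]
  congr 1
  rw [div_pow, mul_pow, Real.sq_sqrt hpos.le]
  field_simp

theorem dissipation_eq_lintegral_costDensity {w p : ℝ → ℝ → ℝ}
    (h : ContinuityEquation κ T γ u w) (hp : ∀ t, Measurable (p t))
    (hu : ∀ t, Measurable (u t))
    (hderiv : ∀ t ∈ Icc 0 T, ∀ s ∈ Icc (-κ) κ, HasDerivAt (u t) (p t s) s)
    (hpos : ∀ t ∈ Icc 0 T, ∀ s ∈ Icc (-κ) κ, 0 < u t s) :
    dissipation κ T γ u
      = ∫⁻ t in Icc 0 T, ∫⁻ s in Icc (-κ) κ, costDensity (w t s) (p t s) (u t s) := by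
  have hvalue (t : ℝ) (ht : t ∈ Icc 0 T) (v : ℝ → ℝ)
      (hv : ∀ᵐ s ∂volume.restrict (Icc (-κ) κ), v s = w t s) :
      2⁻¹ * (∫⁻ s in Icc (-κ) κ, sqDiv (v s) (u t s))
        + 2 * ∫⁻ s in Icc (-κ) κ, ENNReal.ofReal ((deriv (fun r => Real.sqrt (u t r)) s) ^ 2)
      = ∫⁻ s in Icc (-κ) κ, costDensity (w t s) (p t s) (u t s) := by
    rw [← lintegral_const_mul' _ _ (by simp), ← lintegral_const_mul' _ _ (by simp),
      ← lintegral_add_right' _ ?_]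
    · refine lintegral_congr_ae ?_
      filter_upwards [hv, ae_restrict_mem measurableSet_Icc] with s hvs hs
      rw [hvs, two_mul_deriv_sqrt_sq (hderiv t ht s hs) (hpos t ht s hs), costDensity, mul_comm,
        ← div_eq_mul_inv]
    · have hmeas : Measurable fun s => sqDiv (p t s) (u t s) / 2 :=
        (measurable_sqDiv (hp t) (hu t)).div_const 2
      refine hmeas.aemeasurable.congr ?_
      filter_upwards [ae_restrict_mem measurableSet_Icc] with s hs
      exact (two_mul_deriv_sqrt_sq (hderiv t ht s hs) (hpos t ht s hs)).symm
  refine le_antisymm ?_ (le_iInf₂ fun v hv => le_of_eq ?_)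
  · exact iInf₂_le_of_le w h (setLIntegral_congr_fun measurableSet_Icc fun t ht =>
      hvalue t ht _ (Eventually.of_forall fun _ => rfl)).le
  · refine lintegral_congr_ae ?_
    filter_upwards [hv.flux_ae_eq h, ae_restrict_mem measurableSet_Icc] with t hvt ht
    exact (hvalue t ht _ hvt).symm

end FluxUniqueness

section LeftMean

variable {κ T : ℝ} {γ : Measure ℝ}

/-- The flux through `s` that transports the (signed, mean-zero) mass distribution `f γ` away:
`-leftMean γ f` has distributional derivative `-f γ`. -/
noncomputable def leftMean (γ : Measure ℝ) (f : ℝ → ℝ) (s : ℝ) : ℝ := ∫ r in Iio s, f r ∂γ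

theorem leftMean_eq_integral_indicator (γ : Measure ℝ) (f : ℝ → ℝ) (s : ℝ) :
    leftMean γ f s = ∫ r, (Iio s).indicator f r ∂γ := by
  rw [leftMean, integral_indicator measurableSet_Iio]

theorem measurable_indicator_Iio {f : ℝ → ℝ → ℝ} (hf : Measurable (Function.uncurry f)) :
    Measurable fun p : (ℝ × ℝ) × ℝ => (Iio p.1.2).indicator (f p.1.1) p.2 := by
  have hind : (fun p : (ℝ × ℝ) × ℝ => (Iio p.1.2).indicator (f p.1.1) p.2)
      = {p : (ℝ × ℝ) × ℝ | p.2 < p.1.2}.indicator fun p => f p.1.1 p.2 := by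
    ext p
    simp [indicator]
  rw [hind]
  exact (hf.comp (by fun_prop : Measurable fun p : (ℝ × ℝ) × ℝ => (p.1.1, p.2))).indicator
    (measurableSet_lt measurable_snd (measurable_snd.comp measurable_fst))

theorem measurable_leftMean [SFinite γ] {f : ℝ → ℝ → ℝ} (hf : Measurable (Function.uncurry f)) :
    Measurable fun p : ℝ × ℝ => leftMean γ (f p.1) p.2 := by
  simp only [leftMean_eq_integral_indicator]
  exact (measurable_indicator_Iio hf).stronglyMeasurable.integral_prod_right.measurable

theorem abs_leftMean_le [IsProbabilityMeasure γ] {f : ℝ → ℝ} {C : ℝ}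
    (hf : ∀ᵐ s ∂γ, |f s| ≤ C) (s : ℝ) : |leftMean γ f s| ≤ C := by
  have hC : 0 ≤ C := hf.exists.elim fun r hr => (abs_nonneg _).trans hr
  have hbound := norm_setIntegral_le_of_norm_le_const_ae' (s := Iio s) (measure_lt_top γ _)
    (hf.mono fun r hr _ => (Real.norm_eq_abs (f r)).trans_le hr)
  exact hbound.trans (mul_le_of_le_one_right hC measureReal_le_one)

theorem setIntegral_deriv_mul_indicator_Iio {φ : ℝ → ℝ} (hφ : ContDiff ℝ 1 φ) (f : ℝ → ℝ) {r : ℝ}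
    (hr : r ∈ Icc (-κ) κ) :
    ∫ s in Icc (-κ) κ, deriv φ s * (Iio s).indicator f r = (φ κ - φ r) * f r := by
  have hind (s : ℝ) : deriv φ s * (Iio s).indicator f r = (Ioi r).indicator (deriv φ) s * f r := by
    by_cases hrs : r < s <;> simp [hrs]
  have hset : Ioi r ∩ Icc (-κ) κ = Ioc r κ := by
    ext s
    exact ⟨fun hs => ⟨hs.1, hs.2.2⟩, fun hs => ⟨hs.1, hr.1.trans hs.1.le, hs.2⟩⟩
  simp only [hind]
  rw [integral_mul_const, integral_indicator measurableSet_Ioi,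
    Measure.restrict_restrict measurableSet_Ioi, hset, ← intervalIntegral.integral_of_le hr.2,
    intervalIntegral.integral_deriv_eq_sub (fun s _ => hφ.differentiable one_ne_zero s)
      ((hφ.continuous_deriv le_rfl).intervalIntegrable _ _)]

/-- Integration by parts; there is no boundary term at `κ` because `f γ` has no mass. -/
theorem setIntegral_deriv_mul_leftMean [IsFiniteMeasure γ] (hγ : ∀ᵐ s ∂γ, s ∈ Icc (-κ) κ)
    {f : ℝ → ℝ} (hf : Continuous f) (hmean : ∫ s, f s ∂γ = 0) {φ : ℝ → ℝ} (hφ : ContDiff ℝ 1 φ) :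
    ∫ s in Icc (-κ) κ, deriv φ s * leftMean γ f s = -∫ s, φ s * f s ∂γ := by
  have hφ' : Continuous (deriv φ) := hφ.continuous_deriv le_rfl
  have hint : Integrable f γ := integrable_of_ae_mem_Icc hγ hf
  have hφf : Integrable (fun r => φ r * f r) γ :=
    integrable_of_ae_mem_Icc hγ (hφ.continuous.mul hf)
  have hprod : Integrable (Function.uncurry fun s r => deriv φ s * (Iio s).indicator f r)
      ((volume.restrict (Icc (-κ) κ)).prod γ) := by
    have hmeas : Measurable fun p : ℝ × ℝ => (Iio p.1).indicator f p.2 :=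
      (measurable_indicator_Iio (f := fun _ => f) (hf.measurable.comp measurable_snd)).comp
        (by fun_prop : Measurable fun p : ℝ × ℝ => (((0 : ℝ), p.1), p.2))
    refine ((hφ'.continuousOn.integrableOn_Icc).mul_prod hint).mono
      ((hφ'.measurable.comp measurable_fst).mul hmeas).aestronglyMeasurable
      (Eventually.of_forall fun p => ?_)
    simp only [Function.uncurry, norm_mul]
    gcongr
    exact norm_indicator_le_norm_self _ _
  calc ∫ s in Icc (-κ) κ, deriv φ s * leftMean γ f s
      = ∫ s in Icc (-κ) κ, ∫ r, deriv φ s * (Iio s).indicator f r ∂γ := by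
        simp only [leftMean_eq_integral_indicator, integral_const_mul]
    _ = ∫ r, (∫ s in Icc (-κ) κ, deriv φ s * (Iio s).indicator f r) ∂γ :=
        integral_integral_swap hprod
    _ = ∫ r, (φ κ * f r - φ r * f r) ∂γ := integral_congr_ae <| hγ.mono fun r hr =>
        (setIntegral_deriv_mul_indicator_Iio hφ f hr).trans (sub_mul _ _ _)
    _ = -∫ s, φ s * f s ∂γ := by
        rw [integral_sub (hint.const_mul _) hφf, integral_const_mul, hmean, mul_zero, zero_sub]

theorem integrable_prod_of_continuous [IsFiniteMeasure γ] (hγ : ∀ᵐ s ∂γ, s ∈ Icc (-κ) κ)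
    {F : ℝ × ℝ → ℝ} (hF : Continuous F) : Integrable F ((volume.restrict (Icc 0 T)).prod γ) := by
  rw [← Measure.restrict_eq_self_of_ae_mem hγ, Measure.prod_restrict]
  exact hF.continuousOn.integrableOn_compact (isCompact_Icc.prod isCompact_Icc)

theorem hasDerivAt_fst {φ : ℝ × ℝ → ℝ} (hφ : ContDiff ℝ 1 φ) (t s : ℝ) :
    HasDerivAt (fun r => φ (r, s)) (fderiv ℝ φ (t, s) (1, 0)) t :=
  (hφ.differentiable one_ne_zero (t, s)).hasFDerivAt.comp_hasDerivAt t
    ((hasDerivAt_id t).prodMk (hasDerivAt_const t s))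

theorem continuous_deriv_fst {φ : ℝ × ℝ → ℝ} (hφ : ContDiff ℝ 1 φ) :
    Continuous fun p : ℝ × ℝ => deriv (fun r => φ (r, p.2)) p.1 := by
  simp only [fun p : ℝ × ℝ => (hasDerivAt_fst hφ p.1 p.2).deriv]
  exact (hφ.continuous_fderiv one_ne_zero).clm_apply continuous_const

variable {u v : ℝ → ℝ → ℝ}

theorem integral_integral_add_eq_zero [IsFiniteMeasure γ] (hγ : ∀ᵐ s ∂γ, s ∈ Icc (-κ) κ)
    (hT : 0 ≤ T) (hu : Continuous (Function.uncurry u)) (hv : Continuous (Function.uncurry v))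
    (huv : ∀ t s, HasDerivAt (fun r => u r s) (v t s) t) {φ : ℝ × ℝ → ℝ} (hφ : ContDiff ℝ 1 φ)
    (hφT : tsupport φ ⊆ Ioo 0 T ×ˢ univ) :
    (∫ t in Icc 0 T, ∫ s, deriv (fun r => φ (r, s)) t * u t s ∂γ)
      + (∫ t in Icc 0 T, ∫ s, φ (t, s) * v t s ∂γ) = 0 := by
  have hfirst : Continuous fun p : ℝ × ℝ => deriv (fun r => φ (r, p.2)) p.1 * u p.1 p.2 :=
    (continuous_deriv_fst hφ).mul hu
  have hsecond : Continuous fun p : ℝ × ℝ => φ (p.1, p.2) * v p.1 p.2 := hφ.continuous.mul hv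
  have hIfirst := integrable_prod_of_continuous (T := T) hγ hfirst
  have hIsecond := integrable_prod_of_continuous (T := T) hγ hsecond
  refine Eq.trans (congrArg₂ (· + ·) (integral_prod _ hIfirst).symm
    (integral_prod _ hIsecond).symm) ?_
  rw [← integral_add' hIfirst hIsecond, integral_prod_symm _ (hIfirst.add hIsecond)]
  refine integral_eq_zero_of_ae (Eventually.of_forall fun s => ?_)
  have hderiv (t : ℝ) : HasDerivAt (fun r => φ (r, s) * u r s)
      (deriv (fun r => φ (r, s)) t * u t s + φ (t, s) * v t s) t :=
    (hasDerivAt_fst hφ t s).differentiableAt.hasDerivAt.mul (huv t s)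
  have hzero (t : ℝ) (ht : t ∉ Ioo 0 T) : φ (t, s) = 0 :=
    image_eq_zero_of_notMem_tsupport fun hmem => ht (hφT hmem).1
  have hFTC := intervalIntegral.integral_eq_sub_of_hasDerivAt (a := 0) (b := T)
    (fun t _ => hderiv t)
    (((hfirst.add hsecond).comp (Continuous.prodMk_left s)).intervalIntegrable 0 T)
  rw [hzero T (by simp), hzero 0 (by simp), intervalIntegral.integral_of_le hT,
    ← integral_Icc_eq_integral_Ioc] at hFTC
  simpa using hFTC

theorem integrableOn_leftMean [IsProbabilityMeasure γ] (hγ : ∀ᵐ s ∂γ, s ∈ Icc (-κ) κ)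
    (hv : Continuous (Function.uncurry v)) :
    IntegrableOn (fun p : ℝ × ℝ => leftMean γ (v p.1) p.2) (Icc 0 T ×ˢ Icc (-κ) κ) := by
  obtain ⟨C, hC⟩ := ((isCompact_Icc (a := 0) (b := T)).prod
    (isCompact_Icc (a := -κ) (b := κ))).exists_bound_of_continuousOn hv.continuousOn
  refine Measure.integrableOn_of_bounded (M := C)
    (isCompact_Icc.prod isCompact_Icc).measure_lt_top.ne
    (measurable_leftMean hv.measurable).aestronglyMeasurable ?_
  filter_upwards [ae_restrict_mem (measurableSet_Icc.prod measurableSet_Icc)] with p hp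
  exact abs_leftMean_le (hγ.mono fun s hs => hC (p.1, s) ⟨hp.1, hs⟩) p.2

theorem continuityEquation_leftMean [IsProbabilityMeasure γ] (hγ : ∀ᵐ s ∂γ, s ∈ Icc (-κ) κ)
    (hT : 0 ≤ T) (hu : Continuous (Function.uncurry u)) (hv : Continuous (Function.uncurry v))
    (huv : ∀ t s, HasDerivAt (fun r => u r s) (v t s) t) (hmean : ∀ t, ∫ s, v t s ∂γ = 0)
    (hnonneg : ∀ t ∈ Icc 0 T, ∀ s ∈ Icc (-κ) κ, 0 ≤ u t s) :
    ContinuityEquation κ T γ u fun t s => -leftMean γ (v t) s where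
  nonneg := hnonneg
  integrable_density t _ := integrable_of_ae_mem_Icc hγ (hu.comp (Continuous.prodMk_right t))
  weakly_continuous φ hφ :=
    (continuous_parametric_integral_of_continuous (f := fun t s => φ s * u t s)
      ((hφ.comp continuous_snd).mul hu) isCompact_Icc).continuousOn
  integrable_flux := (integrableOn_leftMean hγ hv).neg
  weak_eq φ hφ _ hφT := by
    have hφ₁ : ContDiff ℝ 1 φ := hφ.of_le (by simp)
    have hflux (t : ℝ) : ∫ s in Icc (-κ) κ, deriv (fun r => φ (t, r)) s * -leftMean γ (v t) s
        = ∫ s, φ (t, s) * v t s ∂γ := by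
      have hparts := setIntegral_deriv_mul_leftMean hγ (hv.comp (Continuous.prodMk_right t))
        (hmean t) (hφ₁.comp (contDiff_prodMk_right t))
      simp only [mul_neg, integral_neg]
      exact (congrArg Neg.neg hparts).trans (neg_neg _)
    simp only [hflux, Measure.restrict_eq_self_of_ae_mem hγ]
    exact integral_integral_add_eq_zero hγ hT hu hv huv hφ₁ hφT

end LeftMean

section CenteredProfile

variable {κ m t : ℝ} {γ : Measure ℝ} {b ρ : ℝ → ℝ}

/-- The profile with coefficients `b` and `ρ` whose mean under the probability measure `γ` is `m`.
For smooth `t ↦ (b t, ρ t)` these profiles form the recovery sequence: their time derivative has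
mean zero, so its primitive with respect to `γ` is a flux. -/
noncomputable def centeredProfile (κ m b ρ : ℝ) (γ : Measure ℝ) (s : ℝ) : ℝ :=
  profile κ (m - (b * ∫ r, r / κ ∂γ + ρ * ∫ r, bump κ r ∂γ)) b ρ s

theorem integral_centeredProfile [IsProbabilityMeasure γ] (hγ : ∀ᵐ s ∂γ, s ∈ Icc (-κ) κ)
    (m b ρ : ℝ) : ∫ s, centeredProfile κ m b ρ γ s ∂γ = m := by
  have hlin : Integrable (fun s => b * (s / κ)) γ := integrable_of_ae_mem_Icc hγ (by fun_prop)
  have hbump : Integrable (fun s => ρ * bump κ s) γ := integrable_of_ae_mem_Icc hγ (by fun_prop)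
  simp only [centeredProfile, profile]
  rw [integral_add (integrable_of_ae_mem_Icc hγ (by fun_prop)) hbump,
    integral_add (integrable_const _) hlin, integral_const_mul, integral_const_mul]
  simp only [integral_const, probReal_univ, one_smul]
  ring

theorem continuous_centeredProfile (hb : Continuous b) (hρ : Continuous ρ) :
    Continuous fun p : ℝ × ℝ => centeredProfile κ m (b p.1) (ρ p.1) γ p.2 := by
  unfold centeredProfile profile
  fun_prop

theorem contDiff_centeredProfile (hb : ContDiff ℝ 1 b) (hρ : ContDiff ℝ 1 ρ) :
    ContDiff ℝ 1 fun p : ℝ × ℝ => centeredProfile κ m (b p.1) (ρ p.1) γ p.2 := by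
  unfold centeredProfile profile bump
  fun_prop

theorem hasDerivAt_centeredProfile_time {b' ρ' : ℝ} (hb : HasDerivAt b b' t)
    (hρ : HasDerivAt ρ ρ' t) (s : ℝ) :
    HasDerivAt (fun r => centeredProfile κ m (b r) (ρ r) γ s)
      (centeredProfile κ 0 b' ρ' γ s) t := by
  refine ((((hb.mul_const _).add (hρ.mul_const _)).const_sub m).add (hb.mul_const _)).add
    (hρ.mul_const _) |>.congr_deriv ?_
  rw [centeredProfile, profile, zero_sub]

theorem continuityEquation_centeredProfile [IsProbabilityMeasure γ]
    (hγ : ∀ᵐ s ∂γ, s ∈ Icc (-κ) κ) {T : ℝ} (hT : 0 ≤ T) (hb : ContDiff ℝ 1 b)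
    (hρ : ContDiff ℝ 1 ρ)
    (hnonneg : ∀ t ∈ Icc 0 T, ∀ s ∈ Icc (-κ) κ, 0 ≤ centeredProfile κ m (b t) (ρ t) γ s) :
    ContinuityEquation κ T γ (fun t => centeredProfile κ m (b t) (ρ t) γ)
      fun t s => -leftMean γ (centeredProfile κ 0 (deriv b t) (deriv ρ t) γ) s :=
  continuityEquation_leftMean hγ hT (continuous_centeredProfile hb.continuous hρ.continuous)
    (continuous_centeredProfile (hb.continuous_deriv le_rfl) (hρ.continuous_deriv le_rfl))
    (fun t => hasDerivAt_centeredProfile_time (hb.differentiable one_ne_zero t).hasDerivAt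
      (hρ.differentiable one_ne_zero t).hasDerivAt)
    (fun _ => integral_centeredProfile hγ _ _ _) hnonneg

theorem dissipation_centeredProfile_eq [IsProbabilityMeasure γ]
    (hγ : ∀ᵐ s ∂γ, s ∈ Icc (-κ) κ) {T : ℝ} (hT : 0 ≤ T) (hb : ContDiff ℝ 1 b)
    (hρ : ContDiff ℝ 1 ρ)
    (hpos : ∀ t ∈ Icc 0 T, ∀ s ∈ Icc (-κ) κ, 0 < centeredProfile κ m (b t) (ρ t) γ s) :
    dissipation κ T γ (fun t => centeredProfile κ m (b t) (ρ t) γ)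
      = ∫⁻ t in Icc 0 T, ∫⁻ s in Icc (-κ) κ,
          costDensity (-leftMean γ (centeredProfile κ 0 (deriv b t) (deriv ρ t) γ) s)
            (profileSlope κ (b t) (ρ t) s) (centeredProfile κ m (b t) (ρ t) γ s) :=
  dissipation_eq_lintegral_costDensity
    (continuityEquation_centeredProfile hγ hT hb hρ fun t ht s hs => (hpos t ht s hs).le)
    (fun _ => (continuous_profileSlope _ _ _).measurable)
    (fun t => ((continuous_centeredProfile hb.continuous hρ.continuous).comp
      (Continuous.prodMk_right t)).measurable)
    (fun _ _ s _ => hasDerivAt_profile _ _ _ _ s) hpos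

theorem abs_integral_le_of_ae_abs_le [IsProbabilityMeasure γ] {f : ℝ → ℝ} {C : ℝ}
    (hf : ∀ᵐ s ∂γ, |f s| ≤ C) : |∫ s, f s ∂γ| ≤ C := by
  simpa using norm_integral_le_of_norm_le_const (f := f) hf

theorem abs_div_le_one {s : ℝ} (hs : s ∈ Icc (-κ) κ) : |s / κ| ≤ 1 := by
  rw [abs_div]
  exact div_le_one_of_le₀ ((abs_le.2 hs).trans (le_abs_self κ)) (abs_nonneg κ)

theorem abs_bump_le_one {s : ℝ} (hs : s ∈ Icc (-κ) κ) : |bump κ s| ≤ 1 := by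
  rw [abs_of_nonneg (bump_nonneg hs)]
  exact div_le_one_of_le₀ (by nlinarith [sq_nonneg s, sq_nonneg κ]) (by positivity)

theorem abs_centeredProfile_zero_le [IsProbabilityMeasure γ] (hγ : ∀ᵐ s ∂γ, s ∈ Icc (-κ) κ)
    (b ρ : ℝ) {s : ℝ} (hs : s ∈ Icc (-κ) κ) :
    |centeredProfile κ 0 b ρ γ s| ≤ 2 * (|b| + |ρ|) := by
  have hlin : |s / κ - ∫ r, r / κ ∂γ| ≤ 2 := by
    linarith [abs_sub (s / κ) (∫ r, r / κ ∂γ), abs_div_le_one hs,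
      abs_integral_le_of_ae_abs_le (hγ.mono fun r hr => abs_div_le_one hr)]
  have hbump : |bump κ s - ∫ r, bump κ r ∂γ| ≤ 2 := by
    linarith [abs_sub (bump κ s) (∫ r, bump κ r ∂γ), abs_bump_le_one hs,
      abs_integral_le_of_ae_abs_le (hγ.mono fun r hr => abs_bump_le_one hr)]
  calc |centeredProfile κ 0 b ρ γ s|
      = |b * (s / κ - ∫ r, r / κ ∂γ) + ρ * (bump κ s - ∫ r, bump κ r ∂γ)| := by
        congr 1
        rw [centeredProfile, profile]
        ring
    _ ≤ |b| * 2 + |ρ| * 2 := by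
        refine (abs_add_le _ _).trans (add_le_add ?_ ?_) <;> rw [abs_mul] <;> gcongr
    _ = 2 * (|b| + |ρ|) := by ring

end CenteredProfile

/-- The functional `energyHat` for an arbitrary measure `γ`. -/
noncomputable def energy (γ : Measure ℝ) (u : ℝ → ℝ) : ℝ :=
  (∫ s, u s * Real.log (u s) ∂γ) - (∫ s, u s ∂γ) * Real.log (∫ s, u s ∂γ)

section Recovery

variable {ι : Type*} {l : Filter ι} {κ m T : ℝ} {γ : ι → Measure ℝ} {b ρ : ℝ → ℝ}

theorem tendsto_lintegral_lintegral_of_le_const [l.IsCountablyGenerated] {a b c d : ℝ}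
    {F : ι → ℝ → ℝ → ℝ≥0∞} {G : ℝ → ℝ → ℝ≥0∞} {K : ℝ≥0∞} (hK : K ≠ ⊤)
    (hF : ∀ i, Measurable (Function.uncurry (F i)))
    (hle : ∀ᶠ i in l, ∀ t ∈ Icc a b, ∀ s ∈ Icc c d, F i t s ≤ K)
    (hlim : ∀ t ∈ Icc a b, ∀ s ∈ Ioo c d, Tendsto (fun i => F i t s) l (𝓝 (G t s))) :
    Tendsto (fun i => ∫⁻ t in Icc a b, ∫⁻ s in Icc c d, F i t s) l
      (𝓝 (∫⁻ t in Icc a b, ∫⁻ s in Icc c d, G t s)) := by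
  refine tendsto_lintegral_filter_of_dominated_convergence (fun _ => ∫⁻ _ in Icc c d, K)
    (Eventually.of_forall fun i => (hF i).lintegral_prod_right') ?_
    (by simp [hK, ENNReal.mul_eq_top]) ?_
  · filter_upwards [hle] with i hi
    filter_upwards [ae_restrict_mem measurableSet_Icc] with t ht
    exact setLIntegral_mono' measurableSet_Icc (hi t ht)
  filter_upwards [ae_restrict_mem measurableSet_Icc] with t ht
  refine tendsto_lintegral_filter_of_dominated_convergence (fun _ => K)
    (Eventually.of_forall fun i => (hF i).comp measurable_prodMk_left) ?_
    (by simp [hK, ENNReal.mul_eq_top]) ?_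
  · filter_upwards [hle] with i hi
    filter_upwards [ae_restrict_mem measurableSet_Icc] with s hs
    exact hi t ht s hs
  · rw [← restrict_Ioo_eq_restrict_Icc]
    filter_upwards [ae_restrict_mem measurableSet_Ioo] with s hs
    exact hlim t ht s hs

namespace IsConcentrating

theorem tendsto_integral_div (h : IsConcentrating κ γ l) :
    Tendsto (fun i => ∫ s, s / κ ∂γ i) l (𝓝 0) := by
  simpa [neg_div] using h.tendsto_integral (fun s => s / κ) (by fun_prop)

theorem tendsto_centering (h : IsConcentrating κ γ l) (b ρ : ℝ) :
    Tendsto (fun i => b * ∫ r, r / κ ∂γ i + ρ * ∫ r, bump κ r ∂γ i) l (𝓝 0) := by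
  simpa using (h.tendsto_integral_div.const_mul b).add (h.tendsto_integral_bump.const_mul ρ)

theorem tendsto_centeredProfile (h : IsConcentrating κ γ l) (m b ρ s : ℝ) :
    Tendsto (fun i => centeredProfile κ m b ρ (γ i) s) l (𝓝 (profile κ m b ρ s)) :=
  tendsto_profile (by simpa using (h.tendsto_centering b ρ).const_sub m) tendsto_const_nhds
    tendsto_const_nhds κ s

theorem tendsto_leftMean_centeredProfile (h : IsConcentrating κ γ l) (b ρ : ℝ) {s : ℝ}
    (hs : s ∈ Ioo (-κ) κ) :
    Tendsto (fun i => leftMean (γ i) (centeredProfile κ 0 b ρ (γ i)) s) l (𝓝 (-b / 2)) := by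
  have hκ : 0 < κ := by linarith [hs.1, hs.2]
  have hprofile : Continuous (profile κ 0 b ρ) := (contDiff_profile _ _ _ _).continuous
  have hmass : Tendsto (fun i => (γ i).real (Iio s)) l (𝓝 (1 / 2)) := by
    simpa using h.tendsto_setIntegral_Iio continuous_const (f := fun _ => 1) hs
  have hsplit (i : ι) : leftMean (γ i) (centeredProfile κ 0 b ρ (γ i)) s
      = ∫ r in Iio s, profile κ 0 b ρ r ∂γ i
        - (γ i).real (Iio s) * (b * ∫ r, r / κ ∂γ i + ρ * ∫ r, bump κ r ∂γ i) := by
    have := h.isProbabilityMeasure i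
    have hsub (r : ℝ) : centeredProfile κ 0 b ρ (γ i) r
        = profile κ 0 b ρ r - (b * ∫ r, r / κ ∂γ i + ρ * ∫ r, bump κ r ∂γ i) := by
      simp only [centeredProfile, profile]
      ring
    simp only [leftMean, hsub]
    rw [integral_sub (h.integrable i hprofile).integrableOn (integrable_const _),
      setIntegral_const, smul_eq_mul]
  simpa [hsplit, profile_left hκ] using
    (h.tendsto_setIntegral_Iio hprofile hs).sub (hmass.mul (h.tendsto_centering b ρ))

theorem eventually_forall_le_centeredProfile (h : IsConcentrating κ γ l)
    (hb : Continuous b) (hρ : Continuous ρ) {δ δ' : ℝ} (hδ : δ' < δ)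
    (hlow : ∀ t ∈ Icc 0 T, ∀ s ∈ Icc (-κ) κ, δ ≤ profile κ m (b t) (ρ t) s) :
    ∀ᶠ i in l, ∀ t ∈ Icc 0 T, ∀ s ∈ Icc (-κ) κ,
      δ' ≤ centeredProfile κ m (b t) (ρ t) (γ i) s := by
  obtain ⟨B, hB⟩ := (isCompact_Icc (a := 0) (b := T)).exists_bound_of_continuousOn hb.continuousOn
  obtain ⟨R, hR⟩ := (isCompact_Icc (a := 0) (b := T)).exists_bound_of_continuousOn hρ.continuousOn
  have hsmall : Tendsto (fun i => B * |∫ r, r / κ ∂γ i| + R * |∫ r, bump κ r ∂γ i|) l (𝓝 0) := by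
    simpa using
      (h.tendsto_integral_div.abs.const_mul B).add (h.tendsto_integral_bump.abs.const_mul R)
  filter_upwards [hsmall.eventually_lt_const (sub_pos.2 hδ)] with i hi t ht s hs
  have hlin : b t * ∫ r, r / κ ∂γ i ≤ B * |∫ r, r / κ ∂γ i| := by
    refine (le_abs_self _).trans ?_
    rw [abs_mul]
    exact mul_le_mul_of_nonneg_right (hB t ht) (abs_nonneg _)
  have hbump : ρ t * ∫ r, bump κ r ∂γ i ≤ R * |∫ r, bump κ r ∂γ i| := by
    refine (le_abs_self _).trans ?_
    rw [abs_mul]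
    exact mul_le_mul_of_nonneg_right (hR t ht) (abs_nonneg _)
  have hprofile := hlow t ht s hs
  simp only [centeredProfile, profile] at hprofile ⊢
  linarith

theorem tendsto_energy_centeredProfile (h : IsConcentrating κ γ l) (hκ : 0 < κ) (m b ρ : ℝ) :
    Tendsto (fun i => energy (γ i) (centeredProfile κ m b ρ (γ i))) l
      (𝓝 (energyZero (m - b) (m + b))) := by
  have hcont : Continuous (Function.uncurry fun x s : ℝ =>
      profile κ (m - x) b ρ s * Real.log (profile κ (m - x) b ρ s)) := by
    refine Real.continuous_mul_log.comp (g := fun y : ℝ => y * Real.log y)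
      (f := fun p : ℝ × ℝ => profile κ (m - p.1) b ρ p.2) ?_
    unfold profile
    fun_prop
  have hlim := h.tendsto_integral_comp hcont (h.tendsto_centering b ρ)
  have hmass (i : ι) : ∫ s, centeredProfile κ m b ρ (γ i) s ∂γ i = m :=
    have := h.isProbabilityMeasure i
    integral_centeredProfile (h.ae_mem i) m b ρ
  have hmean : (m - b + (m + b)) / 2 = m := by ring
  simp only [energy, hmass, energyZero, hmean]
  rw [profile_left hκ, profile_right hκ, sub_zero] at hlim
  rw [add_comm ((m + b) * _)]
  exact hlim.sub_const (m * Real.log m)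

theorem exists_costDensity_centeredProfile_le (h : IsConcentrating κ γ l)
    (hb : ContDiff ℝ 1 b) (hρ : ContDiff ℝ 1 ρ) {δ : ℝ} (hδ : 0 < δ) :
    ∃ K : ℝ≥0∞, K ≠ ⊤ ∧ ∀ i, ∀ t ∈ Icc 0 T, ∀ s ∈ Icc (-κ) κ,
      δ ≤ centeredProfile κ m (b t) (ρ t) (γ i) s →
        costDensity (-leftMean (γ i) (centeredProfile κ 0 (deriv b t) (deriv ρ t) (γ i)) s)
          (profileSlope κ (b t) (ρ t) s) (centeredProfile κ m (b t) (ρ t) (γ i) s) ≤ K := by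
  have : Continuous (deriv b) := hb.continuous_deriv le_rfl
  have : Continuous (deriv ρ) := hρ.continuous_deriv le_rfl
  have hslope : Continuous fun p : ℝ × ℝ => profileSlope κ (b p.1) (ρ p.1) p.2 := by
    have := hb.continuous
    have := hρ.continuous
    unfold profileSlope
    fun_prop
  obtain ⟨W, hW⟩ := (isCompact_Icc (a := 0) (b := T)).exists_bound_of_continuousOn
    (f := fun t => 2 * (|deriv b t| + |deriv ρ t|)) (by fun_prop)
  obtain ⟨P, hP⟩ := ((isCompact_Icc (a := 0) (b := T)).prod
    (isCompact_Icc (a := -κ) (b := κ))).exists_bound_of_continuousOn hslope.continuousOn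
  refine ⟨ENNReal.ofReal ((W ^ 2 + P ^ 2) / (2 * δ)), ENNReal.ofReal_ne_top,
    fun i t ht s hs hle => ?_⟩
  have := h.isProbabilityMeasure i
  have hflux : |leftMean (γ i) (centeredProfile κ 0 (deriv b t) (deriv ρ t) (γ i)) s| ≤ W :=
    (abs_leftMean_le ((h.ae_mem i).mono fun r hr =>
      abs_centeredProfile_zero_le (h.ae_mem i) _ _ hr) s).trans ((le_abs_self _).trans (hW t ht))
  rw [costDensity_neg, costDensity_of_pos _ _ (hδ.trans_le hle)]
  refine ENNReal.ofReal_le_ofReal ?_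
  have hw := sq_le_sq' (neg_le_of_abs_le hflux) (le_of_abs_le hflux)
  have hp := sq_le_sq' (neg_le_of_abs_le (hP (t, s) ⟨ht, hs⟩)) (le_of_abs_le (hP (t, s) ⟨ht, hs⟩))
  gcongr

theorem tendsto_dissipation_centeredProfile [l.IsCountablyGenerated] (h : IsConcentrating κ γ l)
    (hT : 0 ≤ T) (hb : ContDiff ℝ 1 b) (hρ : ContDiff ℝ 1 ρ) {δ : ℝ} (hδ : 0 < δ)
    (hlow : ∀ t ∈ Icc 0 T, ∀ s ∈ Icc (-κ) κ, δ ≤ profile κ m (b t) (ρ t) s) :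
    Tendsto (fun i => dissipation κ T (γ i) fun t => centeredProfile κ m (b t) (ρ t) (γ i)) l
      (𝓝 (∫⁻ t in Icc 0 T, profileCost κ m (deriv b t / 2) (b t) (ρ t))) := by
  have hlow' := h.eventually_forall_le_centeredProfile hb.continuous hρ.continuous
    (half_lt_self hδ) hlow
  obtain ⟨K, hK, hle⟩ := h.exists_costDensity_centeredProfile_le (m := m) (T := T) hb hρ
    (half_pos hδ)
  have hslope : Measurable fun p : ℝ × ℝ => profileSlope κ (b p.1) (ρ p.1) p.2 := by
    have := hb.continuous.measurable
    have := hρ.continuous.measurable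
    fun_prop
  have hlim := tendsto_lintegral_lintegral_of_le_const hK (F := fun i t s =>
      costDensity (-leftMean (γ i) (centeredProfile κ 0 (deriv b t) (deriv ρ t) (γ i)) s)
        (profileSlope κ (b t) (ρ t) s) (centeredProfile κ m (b t) (ρ t) (γ i) s))
    (fun i => have := h.isProbabilityMeasure i
      measurable_costDensity (measurable_leftMean (f := fun t =>
        centeredProfile κ 0 (deriv b t) (deriv ρ t) (γ i)) (continuous_centeredProfile
        (hb.continuous_deriv le_rfl) (hρ.continuous_deriv le_rfl)).measurable).neg hslope
        (continuous_centeredProfile hb.continuous hρ.continuous).measurable)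
    (hlow'.mono fun i hi t ht s hs => hle i t ht s hs (hi t ht s hs))
    (fun t ht s hs => tendsto_costDensity (w₀ := deriv b t / 2)
      (by simpa [neg_div] using (h.tendsto_leftMean_centeredProfile (deriv b t) (deriv ρ t) hs).neg)
      tendsto_const_nhds (h.tendsto_centeredProfile m (b t) (ρ t) s)
      (hlow'.mono fun i hi => (half_pos hδ).trans_le (hi t ht s (Ioo_subset_Icc_self hs)))
      (hδ.trans_le (hlow t ht s (Ioo_subset_Icc_self hs))))
  refine hlim.congr' ?_
  filter_upwards [hlow'] with i hi
  have := h.isProbabilityMeasure i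
  exact (dissipation_centeredProfile_eq (h.ae_mem i) hT hb hρ fun t ht s hs =>
    (half_pos hδ).trans_le (hi t ht s hs)).symm

end IsConcentrating

end Recovery

section ProfileIntegral

variable {α : Type*} [MeasurableSpace α] {μ : Measure α} {b ρ : α → ℝ}

theorem integrable_profile [IsFiniteMeasure μ] (κ m : ℝ) (hb : Integrable b μ)
    (hρ : Integrable ρ μ) (s : ℝ) : Integrable (fun x => profile κ m (b x) (ρ x) s) μ :=
  ((integrable_const m).add (hb.mul_const _)).add (hρ.mul_const _)

theorem integrable_profileSlope (κ : ℝ) (hb : Integrable b μ) (hρ : Integrable ρ μ) (s : ℝ) :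
    Integrable (fun x => profileSlope κ (b x) (ρ x) s) μ :=
  (hb.div_const _).sub ((hρ.mul_const _).div_const _)

theorem integral_profile [IsProbabilityMeasure μ] (κ m : ℝ) (hb : Integrable b μ)
    (hρ : Integrable ρ μ) (s : ℝ) :
    ∫ x, profile κ m (b x) (ρ x) s ∂μ = profile κ m (∫ x, b x ∂μ) (∫ x, ρ x ∂μ) s := by
  have hmb : Integrable (fun x => m + b x * (s / κ)) μ := (integrable_const m).add (hb.mul_const _)
  simp only [profile]
  rw [integral_add hmb (hρ.mul_const _), integral_add (integrable_const m) (hb.mul_const _),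
    integral_mul_const, integral_mul_const, integral_const, probReal_univ, one_smul]

theorem integral_profileSlope (κ : ℝ) (hb : Integrable b μ) (hρ : Integrable ρ μ) (s : ℝ) :
    ∫ x, profileSlope κ (b x) (ρ x) s ∂μ = profileSlope κ (∫ x, b x ∂μ) (∫ x, ρ x ∂μ) s := by
  simp only [profileSlope]
  rw [integral_sub (hb.div_const _) ((hρ.mul_const _).div_const _), integral_div, integral_div,
    integral_mul_const]

@[fun_prop]
theorem measurable_profileCost (κ m : ℝ) {w b ρ : α → ℝ} (hw : Measurable w) (hb : Measurable b)
    (hρ : Measurable ρ) : Measurable fun x => profileCost κ m (w x) (b x) (ρ x) :=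
  Measurable.lintegral_prod_right' (f := fun p : α × ℝ => costDensity (w p.1)
    (profileSlope κ (b p.1) (ρ p.1) p.2) (profile κ m (b p.1) (ρ p.1) p.2)) (by fun_prop)

theorem profileCost_anti_mean (κ w b ρ : ℝ) : Antitone fun m => profileCost κ m w b ρ :=
  fun _ _ hm => lintegral_mono fun _ => costDensity_anti _ _
    (profile_mono_mean hm _ _ _ _)

theorem profileCost_le_liminf {κ m₀ w₀ b₀ ρ₀ : ℝ} {m w b ρ : ℕ → ℝ}
    (hm : Tendsto m atTop (𝓝 m₀)) (hw : Tendsto w atTop (𝓝 w₀)) (hb : Tendsto b atTop (𝓝 b₀))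
    (hρ : Tendsto ρ atTop (𝓝 ρ₀))
    (hpos : ∀ n, ∀ s ∈ Icc (-κ) κ, 0 ≤ profile κ (m n) (b n) (ρ n) s) :
    profileCost κ m₀ w₀ b₀ ρ₀
      ≤ liminf (fun n => profileCost κ (m n) (w n) (b n) (ρ n)) atTop := by
  refine le_trans ?_ (lintegral_liminf_le fun n => by fun_prop)
  exact setLIntegral_mono' measurableSet_Icc fun s hs => costDensity_le_liminf hw
    (tendsto_profileSlope hb hρ κ s) (tendsto_profile hm hb hρ κ s) fun n => hpos n s hs

theorem profileCost_integral_le [IsProbabilityMeasure μ] {κ m : ℝ} {w : α → ℝ}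
    (hw : Integrable w μ) (hb : Integrable b μ) (hρ : Integrable ρ μ) (hwm : Measurable w)
    (hbm : Measurable b) (hρm : Measurable ρ)
    (hpos : ∀ x, ∀ s ∈ Icc (-κ) κ, 0 ≤ profile κ m (b x) (ρ x) s) :
    profileCost κ m (∫ x, w x ∂μ) (∫ x, b x ∂μ) (∫ x, ρ x ∂μ)
      ≤ ∫⁻ x, profileCost κ m (w x) (b x) (ρ x) ∂μ := by
  calc profileCost κ m (∫ x, w x ∂μ) (∫ x, b x ∂μ) (∫ x, ρ x ∂μ)
      ≤ ∫⁻ s in Icc (-κ) κ, ∫⁻ x, costDensity (w x) (profileSlope κ (b x) (ρ x) s)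
          (profile κ m (b x) (ρ x) s) ∂μ := by
        refine setLIntegral_mono' measurableSet_Icc fun s hs => ?_
        rw [← integral_profile κ m hb hρ, ← integral_profileSlope κ hb hρ]
        exact costDensity_integral_le hw (integrable_profileSlope κ hb hρ s)
          (integrable_profile κ m hb hρ s) fun x => hpos x s hs
    _ = ∫⁻ x, profileCost κ m (w x) (b x) (ρ x) ∂μ :=
        lintegral_lintegral_swap (Measurable.aemeasurable (by fun_prop))

end ProfileIntegral

section Mollification

variable (φ : ContDiffBump (0 : ℝ)) {g b β : ℝ → ℝ}

/-- The probability measure on `ℝ` whose density is the normalized bump function `φ`. -/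
noncomputable def mollifier : Measure ℝ :=
  volume.withDensity fun r => ENNReal.ofReal (φ.normed volume r)

instance : IsProbabilityMeasure (mollifier φ) where
  measure_univ := by
    rw [mollifier, withDensity_apply _ MeasurableSet.univ, Measure.restrict_univ,
      ← ofReal_integral_eq_lintegral_ofReal φ.integrable_normed
        (Eventually.of_forall φ.nonneg_normed), φ.integral_normed, ENNReal.ofReal_one]

theorem ae_mollifier_mem_ball : ∀ᵐ r ∂mollifier φ, r ∈ Metric.ball 0 φ.rOut := by
  rw [mollifier, ae_withDensity_iff φ.continuous_normed.measurable.ennreal_ofReal]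
  filter_upwards with r hr
  rw [← φ.support_normed_eq (μ := volume), Function.mem_support]
  exact fun h => hr (by rw [h, ENNReal.ofReal_zero])

/-- The mollification of `g` by `φ`, written as an average so that Jensen's inequality applies to
it. -/
noncomputable def mollify (g : ℝ → ℝ) (t : ℝ) : ℝ := ∫ r, g (t - r) ∂mollifier φ

theorem integrable_mollifier_iff {f : ℝ → ℝ} :
    Integrable f (mollifier φ) ↔ Integrable fun r => φ.normed volume r * f r := by
  rw [mollifier, integrable_withDensity_iff_integrable_smul'
    φ.continuous_normed.measurable.ennreal_ofReal (by simp)]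
  simp only [ENNReal.toReal_ofReal (φ.nonneg_normed _), smul_eq_mul]

theorem integral_mollifier (f : ℝ → ℝ) :
    ∫ r, f r ∂mollifier φ = ∫ r, φ.normed volume r * f r := by
  rw [mollifier, integral_withDensity_eq_integral_toReal_smul
    φ.continuous_normed.measurable.ennreal_ofReal (by simp)]
  simp only [ENNReal.toReal_ofReal (φ.nonneg_normed _), smul_eq_mul]

theorem mollify_eq_convolution (g : ℝ → ℝ) :
    mollify φ g = convolution (φ.normed volume) g (ContinuousLinearMap.lsmul ℝ ℝ) volume :=
  funext fun _ => integral_mollifier φ _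

theorem integrable_mollifier_comp_sub (hg : LocallyIntegrable g) (t : ℝ) :
    Integrable (fun r => g (t - r)) (mollifier φ) :=
  (integrable_mollifier_iff φ).2 <| φ.hasCompactSupport_normed.convolutionExists_left
    (ContinuousLinearMap.lsmul ℝ ℝ) φ.continuous_normed hg t

theorem contDiff_mollify (hg : LocallyIntegrable g) : ContDiff ℝ 1 (mollify φ g) := by
  rw [mollify_eq_convolution]
  exact φ.hasCompactSupport_normed.contDiff_convolution_left (n := 1) _ φ.contDiff_normed hg

theorem abs_mollify_le {C : ℝ} (hC : ∀ t, |g t| ≤ C) (t : ℝ) : |mollify φ g t| ≤ C :=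
  abs_integral_le_of_ae_abs_le (Eventually.of_forall fun _ => hC _)

theorem tendsto_mollify {ι : Type*} {l : Filter ι} {φ : ι → ContDiffBump (0 : ℝ)}
    (hφ : Tendsto (fun i => (φ i).rOut) l (𝓝 0)) (hg : Continuous g) (t : ℝ) :
    Tendsto (fun i => mollify (φ i) g t) l (𝓝 (g t)) := by
  simpa only [mollify_eq_convolution] using
    ContDiffBump.convolution_tendsto_right_of_continuous hφ hg t

theorem ae_tendsto_mollify {ι : Type*} {l : Filter ι} {φ : ι → ContDiffBump (0 : ℝ)} {K : ℝ}
    (hφ : Tendsto (fun i => (φ i).rOut) l (𝓝 0))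
    (hφK : ∀ᶠ i in l, (φ i).rOut ≤ K * (φ i).rIn) (hg : LocallyIntegrable g) :
    ∀ᵐ t, Tendsto (fun i => mollify (φ i) g t) l (𝓝 (g t)) := by
  simpa only [mollify_eq_convolution] using
    ContDiffBump.ae_convolution_tendsto_right_of_locallyIntegrable hφ hφK hg

theorem integrable_prod_mollifier (hβ : Integrable β) :
    Integrable (fun p : ℝ × ℝ => β (p.1 - p.2)) (volume.prod (mollifier φ)) := by
  have hmeas : AEStronglyMeasurable (fun p : ℝ × ℝ => β (p.1 - p.2))
      (volume.prod (mollifier φ)) :=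
    hβ.aestronglyMeasurable.comp_quasiMeasurePreserving
      (quasiMeasurePreserving_sub_of_right_invariant _ _)
  rw [integrable_prod_iff' hmeas]
  refine ⟨Eventually.of_forall fun r => hβ.comp_sub_right r, ?_⟩
  simp only [integral_sub_right_eq_self fun t => ‖β t‖]
  exact integrable_const _

theorem deriv_mollify (hβ : Integrable β) (hbc : Continuous b)
    (hb : ∀ s t, b t - b s = ∫ r in s..t, β r) : deriv (mollify φ b) = mollify φ β := by
  have hcont : Continuous (mollify φ β) := (contDiff_mollify φ hβ.locallyIntegrable).continuous
  have hprimitive (t : ℝ) : mollify φ b t = mollify φ b 0 + ∫ τ in (0 : ℝ)..t, mollify φ β τ := by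
    have hprod : Integrable (Function.uncurry fun τ r => β (τ - r))
        ((volume.restrict (uIoc 0 t)).prod (mollifier φ)) :=
      (integrable_prod_mollifier φ hβ).mono_measure
        (Measure.prod_mono Measure.restrict_le_self le_rfl)
    unfold mollify
    rw [intervalIntegral_integral_swap hprod, ← sub_eq_iff_eq_add',
      ← integral_sub (integrable_mollifier_comp_sub φ hbc.locallyIntegrable t)
        (integrable_mollifier_comp_sub φ hbc.locallyIntegrable 0)]
    simp only [hb, intervalIntegral.integral_comp_sub_right]
  ext t
  rw [funext hprimitive]
  exact ((intervalIntegral.integral_hasDerivAt_right (hcont.intervalIntegrable _ _)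
    (hcont.stronglyMeasurableAtFilter _ _) hcont.continuousAt).const_add _).deriv

theorem lintegral_mollifier_comp_sub_le (a c : ℝ) {G : ℝ → ℝ≥0∞} (hG : Measurable G) :
    ∫⁻ t in Icc a c, ∫⁻ r, G (t - r) ∂mollifier φ
      ≤ ∫⁻ t in Icc (a - φ.rOut) (c + φ.rOut), G t := by
  have hshift {r : ℝ} (hr : r ∈ Metric.ball 0 φ.rOut) :
      ∫⁻ t in Icc a c, G (t - r) ≤ ∫⁻ t in Icc (a - φ.rOut) (c + φ.rOut), G t := by
    rw [Metric.mem_ball, Real.dist_eq, sub_zero, abs_lt] at hr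
    rw [← lintegral_indicator measurableSet_Icc, ← lintegral_indicator measurableSet_Icc,
      ← lintegral_sub_right_eq_self ((Icc (a - φ.rOut) (c + φ.rOut)).indicator G) r]
    refine lintegral_mono (indicator_le fun t ht => ?_)
    rw [indicator_of_mem]
    constructor <;> linarith [ht.1, ht.2]
  calc ∫⁻ t in Icc a c, ∫⁻ r, G (t - r) ∂mollifier φ
      = ∫⁻ r, (∫⁻ t in Icc a c, G (t - r)) ∂mollifier φ :=
        lintegral_lintegral_swap (hG.comp measurable_sub).aemeasurable
    _ ≤ ∫⁻ _, (∫⁻ t in Icc (a - φ.rOut) (c + φ.rOut), G t) ∂mollifier φ :=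
        lintegral_mono_ae ((ae_mollifier_mem_ball φ).mono fun _ => hshift)
    _ = ∫⁻ t in Icc (a - φ.rOut) (c + φ.rOut), G t := by
        rw [lintegral_const, measure_univ, mul_one]

end Mollification

section CostMollification

theorem lintegral_Icc_enlarge_le {a c d : ℝ} {G : ℝ → ℝ≥0∞} {C : ℝ≥0∞}
    (hG : ∀ t ∉ Icc a c, G t ≤ C) :
    ∫⁻ t in Icc (a - d) (c + d), G t
      ≤ (∫⁻ t in Icc a c, G t) + (C * ENNReal.ofReal d + C * ENNReal.ofReal d) := by
  have hsub : Icc (a - d) (c + d) ⊆ Icc a c ∪ (Ico (a - d) a ∪ Ioc c (c + d)) := by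
    intro t ht
    grind
  have hleft : ∫⁻ t in Ico (a - d) a, G t ≤ C * ENNReal.ofReal d :=
    (setLIntegral_mono' measurableSet_Ico fun t ht => hG t fun h => ht.2.not_ge h.1).trans_eq
      (by rw [setLIntegral_const, Real.volume_Ico, sub_sub_cancel])
  have hright : ∫⁻ t in Ioc c (c + d), G t ≤ C * ENNReal.ofReal d :=
    (setLIntegral_mono' measurableSet_Ioc fun t ht => hG t fun h => ht.1.not_ge h.2).trans_eq
      (by rw [setLIntegral_const, Real.volume_Ioc, add_sub_cancel_left])
  calc ∫⁻ t in Icc (a - d) (c + d), G t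
      ≤ ∫⁻ t in Icc a c ∪ (Ico (a - d) a ∪ Ioc c (c + d)), G t := lintegral_mono_set hsub
    _ ≤ (∫⁻ t in Icc a c, G t) + (C * ENNReal.ofReal d + C * ENNReal.ofReal d) :=
        (lintegral_union_le _ _ _).trans (add_le_add_right
          ((lintegral_union_le _ _ _).trans (add_le_add hleft hright)) _)

variable {κ m a c : ℝ} {w b ρ : ℝ → ℝ}

theorem profile_mollify_nonneg (φ : ContDiffBump (0 : ℝ)) (hb : LocallyIntegrable b)
    (hρ : LocallyIntegrable ρ) (hpos : ∀ t, ∀ s ∈ Icc (-κ) κ, 0 ≤ profile κ m (b t) (ρ t) s)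
    (t : ℝ) {s : ℝ} (hs : s ∈ Icc (-κ) κ) :
    0 ≤ profile κ m (mollify φ b t) (mollify φ ρ t) s := by
  unfold mollify
  rw [← integral_profile κ m (integrable_mollifier_comp_sub φ hb t)
    (integrable_mollifier_comp_sub φ hρ t)]
  exact integral_nonneg fun r => hpos (t - r) s hs

theorem lintegral_profileCost_mollify_le (φ : ContDiffBump (0 : ℝ)) (hwm : Measurable w)
    (hbm : Measurable b) (hρm : Measurable ρ) (hw : LocallyIntegrable w)
    (hb : LocallyIntegrable b) (hρ : LocallyIntegrable ρ)
    (hpos : ∀ t, ∀ s ∈ Icc (-κ) κ, 0 ≤ profile κ m (b t) (ρ t) s) {C : ℝ≥0∞}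
    (hC : ∀ t ∉ Icc a c, profileCost κ m (w t) (b t) (ρ t) ≤ C) :
    ∫⁻ t in Icc a c, profileCost κ m (mollify φ w t) (mollify φ b t) (mollify φ ρ t)
      ≤ (∫⁻ t in Icc a c, profileCost κ m (w t) (b t) (ρ t))
        + (C * ENNReal.ofReal φ.rOut + C * ENNReal.ofReal φ.rOut) :=
  calc ∫⁻ t in Icc a c, profileCost κ m (mollify φ w t) (mollify φ b t) (mollify φ ρ t)
      ≤ ∫⁻ t in Icc a c, ∫⁻ r, profileCost κ m (w (t - r)) (b (t - r)) (ρ (t - r)) ∂mollifier φ :=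
        lintegral_mono fun t => profileCost_integral_le (integrable_mollifier_comp_sub φ hw t)
          (integrable_mollifier_comp_sub φ hb t) (integrable_mollifier_comp_sub φ hρ t)
          (by fun_prop) (by fun_prop) (by fun_prop) fun r => hpos (t - r)
    _ ≤ ∫⁻ t in Icc (a - φ.rOut) (c + φ.rOut), profileCost κ m (w t) (b t) (ρ t) :=
        lintegral_mollifier_comp_sub_le φ a c (measurable_profileCost κ m hwm hbm hρm)
    _ ≤ _ := lintegral_Icc_enlarge_le hC

theorem lintegral_profileCost_le_liminf_mollify {φ : ℕ → ContDiffBump (0 : ℝ)} {K : ℝ}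
    (hφ : Tendsto (fun n => (φ n).rOut) atTop (𝓝 0))
    (hφK : ∀ᶠ n in atTop, (φ n).rOut ≤ K * (φ n).rIn) (hw : LocallyIntegrable w)
    (hb : LocallyIntegrable b) (hρ : LocallyIntegrable ρ)
    (hpos : ∀ t, ∀ s ∈ Icc (-κ) κ, 0 ≤ profile κ m (b t) (ρ t) s) {δ : ℕ → ℝ}
    (hδ : Tendsto δ atTop (𝓝 0)) (hδ0 : ∀ n, 0 ≤ δ n) (A : Set ℝ) :
    ∫⁻ t in A, profileCost κ m (w t) (b t) (ρ t)
      ≤ liminf (fun n => ∫⁻ t in A, profileCost κ (m + δ n) (mollify (φ n) w t)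
          (mollify (φ n) b t) (mollify (φ n) ρ t)) atTop := by
  have hm : Tendsto (fun n => m + δ n) atTop (𝓝 m) := by simpa using hδ.const_add m
  have hmeas {g : ℝ → ℝ} (hg : LocallyIntegrable g) (n : ℕ) : Measurable (mollify (φ n) g) :=
    (contDiff_mollify (φ n) hg).continuous.measurable
  refine le_trans ?_ (lintegral_liminf_le fun n => measurable_profileCost κ (m + δ n)
    (hmeas hw n) (hmeas hb n) (hmeas hρ n))
  refine lintegral_mono_ae (ae_restrict_of_ae ?_)
  filter_upwards [ae_tendsto_mollify hφ hφK hw, ae_tendsto_mollify hφ hφK hb,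
    ae_tendsto_mollify hφ hφK hρ] with t hwt hbt hρt
  refine profileCost_le_liminf hm hwt hbt hρt fun n s hs => ?_
  exact (profile_mollify_nonneg (φ n) hb hρ hpos t hs).trans
    (profile_mono_mean (le_add_of_nonneg_right (hδ0 n)) _ _ _ _)

theorem tendsto_lintegral_profileCost_mollify {φ : ℕ → ContDiffBump (0 : ℝ)} {K : ℝ}
    (hφ : Tendsto (fun n => (φ n).rOut) atTop (𝓝 0))
    (hφK : ∀ᶠ n in atTop, (φ n).rOut ≤ K * (φ n).rIn) (hwm : Measurable w) (hbm : Measurable b)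
    (hρm : Measurable ρ) (hw : LocallyIntegrable w) (hb : LocallyIntegrable b)
    (hρ : LocallyIntegrable ρ) (hpos : ∀ t, ∀ s ∈ Icc (-κ) κ, 0 ≤ profile κ m (b t) (ρ t) s)
    {C : ℝ≥0∞} (hCtop : C ≠ ⊤) (hC : ∀ t ∉ Icc a c, profileCost κ m (w t) (b t) (ρ t) ≤ C)
    {δ : ℕ → ℝ} (hδ : Tendsto δ atTop (𝓝 0)) (hδ0 : ∀ n, 0 ≤ δ n) :
    Tendsto (fun n => ∫⁻ t in Icc a c, profileCost κ (m + δ n) (mollify (φ n) w t)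
        (mollify (φ n) b t) (mollify (φ n) ρ t)) atTop
      (𝓝 (∫⁻ t in Icc a c, profileCost κ m (w t) (b t) (ρ t))) := by
  set J := ∫⁻ t in Icc a c, profileCost κ m (w t) (b t) (ρ t)
  have hrest : Tendsto (fun n => C * ENNReal.ofReal (φ n).rOut) atTop (𝓝 0) := by
    simpa using ENNReal.Tendsto.const_mul (ENNReal.tendsto_ofReal hφ) (Or.inr hCtop)
  have hJ : Tendsto (fun n => J + (C * ENNReal.ofReal (φ n).rOut
      + C * ENNReal.ofReal (φ n).rOut)) atTop (𝓝 J) := by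
    simpa using (hrest.add hrest).const_add J
  refine tendsto_of_le_liminf_of_limsup_le
    (lintegral_profileCost_le_liminf_mollify hφ hφK hw hb hρ hpos hδ hδ0 _) ?_
  rw [← hJ.limsup_eq]
  refine limsup_le_limsup (Eventually.of_forall fun n => ?_)
  exact (lintegral_mono fun t => profileCost_anti_mean _ _ _ _
    (le_add_of_nonneg_right (hδ0 n))).trans
      (lintegral_profileCost_mollify_le (φ n) hwm hbm hρm hw hb hρ hpos hC)

end CostMollification

section Path

variable {κ T m : ℝ} {b β : ℝ → ℝ}

theorem eq_of_sub_eq_integral {s t : ℝ} (hst : s ≤ t) (hb : b t - b s = ∫ r in s..t, β r)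
    (hβ : ∀ r ∈ Ioo s t, β r = 0) : b t = b s := by
  rw [← sub_eq_zero, hb, intervalIntegral.integral_of_le hst, ← restrict_Ioo_eq_restrict_Ioc,
    setIntegral_eq_zero_of_forall_eq_zero hβ]

theorem apply_eq_apply_zero_of_rest (hb : ∀ s t, b t - b s = ∫ r in s..t, β r)
    (hrest : ∀ t ∉ Icc 0 T, β t = 0) {t : ℝ} (ht : t < 0) : b t = b 0 :=
  (eq_of_sub_eq_integral ht.le (hb t 0) fun r hr => hrest r fun h => hr.2.not_ge h.1).symm

theorem apply_eq_apply_end_of_rest (hb : ∀ s t, b t - b s = ∫ r in s..t, β r)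
    (hrest : ∀ t ∉ Icc 0 T, β t = 0) {t : ℝ} (ht : T < t) : b t = b T :=
  eq_of_sub_eq_integral ht.le (hb T t) fun r hr => hrest r fun h => hr.1.not_ge h.2

/-- A curve `t ↦ (u⁻, u⁺) = (m - b t, m + b t)` of nonnegative boundary data with integrable
velocity `b' = β`, at rest outside `[0, T]`. It is defined for all times so that it can be
mollified. -/
structure IsPath (T m : ℝ) (b β : ℝ → ℝ) : Prop where
  measurable : Measurable β
  integrable : Integrable β
  sub_eq : ∀ s t, b t - b s = ∫ r in s..t, β r
  bound : ∀ t, |b t| ≤ m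
  rest : ∀ t ∉ Icc 0 T, β t = 0

/-- The coefficient of `bump` in the minimiser of `M` along a path. -/
noncomputable def pathCoeff (κ m : ℝ) (b β : ℝ → ℝ) (t : ℝ) : ℝ :=
  optCoeff κ (β t / 2) (m - b t) (m + b t)

theorem optCost_sub_add (κ w m b : ℝ) :
    optCost κ w (m - b) (m + b) = profileCost κ m w b (optCoeff κ w (m - b) (m + b)) := by
  have hmean : (m - b + (m + b)) / 2 = m := by ring
  have hdiff : (m + b - (m - b)) / 2 = b := by ring
  simp only [optCost, optSlope, optProfile, profileCost, hmean, hdiff]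

theorem optCost_neg (κ w um up : ℝ) : optCost κ (-w) um up = optCost κ w um up := by
  simp only [optCost, optSlope, optProfile, optCoeff, costDensity_neg, neg_sq]

theorem abs_optCoeff_le (hκ : 0 ≤ κ) (w : ℝ) {um up : ℝ} (hum : 0 ≤ um) (hup : 0 ≤ up) :
    |optCoeff κ w um up| ≤ um + up + κ * |w| := by
  have hsqrt : √(um * up + κ ^ 2 * w ^ 2) ≤ (um + up) + κ * |w| := by
    rw [Real.sqrt_le_left (by positivity), ← sq_abs w]
    have : 0 ≤ (um + up) * (κ * |w|) := by positivity
    nlinarith [mul_nonneg hum hup]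
  have := Real.sqrt_nonneg (um * up + κ ^ 2 * w ^ 2)
  have : 0 ≤ κ * |w| := by positivity
  rw [optCoeff, abs_le]
  constructor <;> linarith

namespace IsPath

theorem continuous (h : IsPath T m b β) : Continuous b := by
  have : b = fun t => b 0 + ∫ r in (0 : ℝ)..t, β r := by
    ext t
    rw [← h.sub_eq 0 t, add_sub_cancel]
  rw [this]
  exact continuous_const.add (intervalIntegral.continuous_primitive
    (fun _ _ => h.integrable.intervalIntegrable) 0)

theorem sub_nonneg (h : IsPath T m b β) (t : ℝ) : 0 ≤ m - b t := by
  linarith [(abs_le.1 (h.bound t)).2]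

theorem add_nonneg (h : IsPath T m b β) (t : ℝ) : 0 ≤ m + b t := by
  linarith [(abs_le.1 (h.bound t)).1]

theorem measurable_pathCoeff (h : IsPath T m b β) (κ : ℝ) : Measurable (pathCoeff κ m b β) := by
  have := h.continuous.measurable
  have := h.measurable
  unfold pathCoeff optCoeff
  fun_prop

theorem locallyIntegrable_pathCoeff (h : IsPath T m b β) (hκ : 0 ≤ κ) :
    LocallyIntegrable (pathCoeff κ m b β) := by
  have hdom : LocallyIntegrable fun t => 2 * m + κ * |β t / 2| :=
    (locallyIntegrable_const _).add ((h.integrable.div_const 2).abs.const_mul κ).locallyIntegrable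
  refine hdom.mono (h.measurable_pathCoeff κ).aestronglyMeasurable
    (Eventually.of_forall fun t => ?_)
  refine (abs_optCoeff_le hκ (β t / 2) (h.sub_nonneg t) (h.add_nonneg t)).trans
    (le_trans (le_of_eq ?_) (le_abs_self _))
  ring

theorem profile_nonneg (h : IsPath T m b β) (hκ : 0 < κ) (t : ℝ) {s : ℝ} (hs : s ∈ Icc (-κ) κ) :
    0 ≤ profile κ m (b t) (pathCoeff κ m b β t) s := by
  have hmean : (m - b t + (m + b t)) / 2 = m := by ring
  have hdiff : (m + b t - (m - b t)) / 2 = b t := by ring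
  have := optProfile_nonneg hκ (β t / 2) (h.sub_nonneg t) (h.add_nonneg t) hs
  rwa [optProfile, hmean, hdiff] at this

theorem profileCost_le_of_notMem (h : IsPath T m b β) (κ : ℝ) {t : ℝ} (ht : t ∉ Icc 0 T) :
    profileCost κ m (β t / 2) (b t) (pathCoeff κ m b β t)
      ≤ optCost κ 0 (m - b 0) (m + b 0) + optCost κ 0 (m - b T) (m + b T) := by
  rw [pathCoeff, ← optCost_sub_add, h.rest t ht, zero_div]
  rcases lt_or_ge t 0 with h0 | h0
  · rw [apply_eq_apply_zero_of_rest h.sub_eq h.rest h0]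
    exact le_self_add
  · rw [apply_eq_apply_end_of_rest h.sub_eq h.rest (lt_of_not_ge fun hT => ht ⟨h0, hT⟩)]
    exact le_add_self

theorem tendsto_lintegral_profileCost (h : IsPath T m b β) (hκ : 0 < κ)
    {φ : ℕ → ContDiffBump (0 : ℝ)} {K : ℝ} (hφ : Tendsto (fun n => (φ n).rOut) atTop (𝓝 0))
    (hφK : ∀ᶠ n in atTop, (φ n).rOut ≤ K * (φ n).rIn) :
    Tendsto (fun n => ∫⁻ t in Icc 0 T, profileCost κ (m + (φ n).rOut)
        (deriv (mollify (φ n) b) t / 2) (mollify (φ n) b t)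
        (mollify (φ n) (pathCoeff κ m b β) t)) atTop
      (𝓝 (∫⁻ t in Icc 0 T, optCost κ (β t / 2) (m - b t) (m + b t))) := by
  have hrest : optCost κ 0 (m - b 0) (m + b 0) + optCost κ 0 (m - b T) (m + b T) ≠ ⊤ :=
    ENNReal.add_ne_top.2 ⟨(optCost_zero_lt_top hκ (h.sub_nonneg 0) (h.add_nonneg 0)).ne,
      (optCost_zero_lt_top hκ (h.sub_nonneg T) (h.add_nonneg T)).ne⟩
  have hflux (n : ℕ) (t : ℝ) :
      mollify (φ n) (fun r => β r / 2) t = deriv (mollify (φ n) b) t / 2 := by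
    rw [deriv_mollify (φ n) h.integrable h.continuous h.sub_eq, mollify, mollify, integral_div]
  simpa only [hflux, optCost_sub_add, pathCoeff] using
    tendsto_lintegral_profileCost_mollify hφ hφK (h.measurable.div_const 2)
      h.continuous.measurable (h.measurable_pathCoeff κ)
      (h.integrable.div_const 2).locallyIntegrable h.continuous.locallyIntegrable
      (h.locallyIntegrable_pathCoeff hκ.le) (fun t s hs => h.profile_nonneg hκ t hs) hrest
      (fun t ht => h.profileCost_le_of_notMem κ ht) hφ fun n => (φ n).rOut_pos.le

theorem rOut_le_profile_mollify (h : IsPath T m b β) (hκ : 0 < κ) (φ : ContDiffBump (0 : ℝ))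
    (t : ℝ) {s : ℝ} (hs : s ∈ Icc (-κ) κ) :
    φ.rOut ≤ profile κ (m + φ.rOut) (mollify φ b t) (mollify φ (pathCoeff κ m b β) t) s := by
  have := profile_mollify_nonneg φ h.continuous.locallyIntegrable
    (h.locallyIntegrable_pathCoeff hκ.le) (fun t s hs => h.profile_nonneg hκ t hs) t hs
  unfold profile at this ⊢
  linarith

end IsPath

end Path

section LimitFunctional

variable {κ T m : ℝ} {b β um up : ℝ → ℝ}

open Classical in
/-- The functional `dissipationZero` for an arbitrary half-length `κ` of the interval. -/
noncomputable def limitDissipation (κ T : ℝ) (um up : ℝ → ℝ) : ℝ≥0∞ :=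
  if AbsolutelyContinuousOnInterval um 0 T ∧ AbsolutelyContinuousOnInterval up 0 T ∧
      (∀ t ∈ Icc 0 T, 0 ≤ um t ∧ 0 ≤ up t) ∧
      (∀ᵐ t ∂(volume.restrict (Icc 0 T)), deriv um t = -deriv up t)
  then ∫⁻ t in Icc 0 T, M κ (deriv um t / 2) (um t) (up t)
  else ∞

theorem integral_deriv_eq_sub_of_mem_Icc {f : ℝ → ℝ} (hf : AbsolutelyContinuousOnInterval f 0 T)
    {t : ℝ} (ht : t ∈ Icc 0 T) : ∫ r in (0 : ℝ)..t, deriv f r = f t - f 0 := by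
  refine (hf.mono ?_).integral_deriv_eq_sub
  rw [uIcc_of_le ht.1, uIcc_of_le (ht.1.trans ht.2)]
  exact Icc_subset_Icc_right ht.2

theorem sub_eq_sub_of_deriv_eq_neg (hum : AbsolutelyContinuousOnInterval um 0 T)
    (hup : AbsolutelyContinuousOnInterval up 0 T)
    (hd : ∀ᵐ t ∂(volume.restrict (Icc 0 T)), deriv um t = -deriv up t) {t : ℝ}
    (ht : t ∈ Icc 0 T) : um t - um 0 = up 0 - up t := by
  rw [← neg_sub (up t), ← integral_deriv_eq_sub_of_mem_Icc hum ht,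
    ← integral_deriv_eq_sub_of_mem_Icc hup ht, ← intervalIntegral.integral_neg]
  refine intervalIntegral.integral_congr_ae ?_
  rw [ae_restrict_iff' measurableSet_Icc] at hd
  filter_upwards [hd] with r hr hrt
  rw [uIoc_of_le ht.1] at hrt
  exact hr ⟨hrt.1.le, hrt.2.trans ht.2⟩

theorem isPath_of_abs_le (hT : 0 ≤ T) (hβm : Measurable β) (hβ : Integrable β)
    (hb : ∀ s t, b t - b s = ∫ r in s..t, β r) (hbound : ∀ t ∈ Icc 0 T, |b t| ≤ m)
    (hrest : ∀ t ∉ Icc 0 T, β t = 0) : IsPath T m b β := by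
  refine ⟨hβm, hβ, hb, fun t => ?_, hrest⟩
  rcases lt_or_ge t 0 with h0 | h0
  · rw [apply_eq_apply_zero_of_rest hb hrest h0]
    exact hbound 0 ⟨le_rfl, hT⟩
  rcases le_or_gt t T with h1 | h1
  · exact hbound t ⟨h0, h1⟩
  · rw [apply_eq_apply_end_of_rest hb hrest h1]
    exact hbound T ⟨hT, le_rfl⟩

theorem exists_isPath_of_deriv_eq_neg (hT : 0 ≤ T) (hum : AbsolutelyContinuousOnInterval um 0 T)
    (hup : AbsolutelyContinuousOnInterval up 0 T)
    (hnonneg : ∀ t ∈ Icc 0 T, 0 ≤ um t ∧ 0 ≤ up t)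
    (hd : ∀ᵐ t ∂(volume.restrict (Icc 0 T)), deriv um t = -deriv up t) :
    ∃ m b, IsPath T m b ((Icc 0 T).indicator fun t => -deriv um t) ∧
      ∀ t ∈ Icc 0 T, um t = m - b t ∧ up t = m + b t := by
  set β : ℝ → ℝ := (Icc 0 T).indicator fun t => -deriv um t
  set b : ℝ → ℝ := fun t => (up 0 - um 0) / 2 + ∫ r in (0 : ℝ)..t, β r
  have hβ : Integrable β := by
    have := hum.intervalIntegrable_deriv
    rw [intervalIntegrable_iff_integrableOn_Icc_of_le hT] at this
    exact this.neg.integrable_indicator measurableSet_Icc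
  have hb (s t : ℝ) : b t - b s = ∫ r in s..t, β r := by
    rw [add_sub_add_left_eq_sub, intervalIntegral.integral_interval_sub_left
      hβ.intervalIntegrable hβ.intervalIntegrable]
  have hval (t : ℝ) (ht : t ∈ Icc 0 T) :
      um t = (um 0 + up 0) / 2 - b t ∧ up t = (um 0 + up 0) / 2 + b t := by
    have hprimitive : ∫ r in (0 : ℝ)..t, β r = um 0 - um t := by
      rw [← neg_sub (um t), ← integral_deriv_eq_sub_of_mem_Icc hum ht,
        ← intervalIntegral.integral_neg]
      refine intervalIntegral.integral_congr fun r hr => ?_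
      rw [uIcc_of_le ht.1] at hr
      exact indicator_of_mem (s := Icc 0 T) ⟨hr.1, hr.2.trans ht.2⟩ _
    have hsum := sub_eq_sub_of_deriv_eq_neg hum hup hd ht
    simp only [b, hprimitive]
    constructor <;> linarith
  refine ⟨(um 0 + up 0) / 2, b, isPath_of_abs_le hT
    ((measurable_deriv um).neg.indicator measurableSet_Icc) hβ hb (fun t ht => ?_)
    (fun t ht => indicator_of_notMem ht _), hval⟩
  rw [abs_le]
  constructor <;> linarith [hval t ht, hnonneg t ht]

theorem exists_isPath (hκ : 0 < κ) (hT : 0 ≤ T) (hJ : limitDissipation κ T um up < ⊤) :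
    ∃ m b β, IsPath T m b β ∧ (∀ t ∈ Icc 0 T, um t = m - b t ∧ up t = m + b t) ∧
      limitDissipation κ T um up
        = ∫⁻ t in Icc 0 T, optCost κ (β t / 2) (m - b t) (m + b t) := by
  rw [limitDissipation] at hJ ⊢
  split_ifs at hJ ⊢ with hcond
  · obtain ⟨hum, hup, hnonneg, hd⟩ := hcond
    obtain ⟨m, b, hpath, hval⟩ := exists_isPath_of_deriv_eq_neg hT hum hup hnonneg hd
    refine ⟨m, b, _, hpath, hval, setLIntegral_congr_fun measurableSet_Icc fun t ht => ?_⟩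
    rw [M_eq_optCost hκ _ (hnonneg t ht).1 (hnonneg t ht).2, indicator_of_mem ht, neg_div,
      optCost_neg, ← (hval t ht).1, ← (hval t ht).2]
  · exact absurd hJ (lt_irrefl _)

end LimitFunctional

section Diagonal

variable {ι X : Type*} {l : Filter ι} [TopologicalSpace X] {a : X}

theorem exists_tendsto_nat_atTop [l.IsCountablyGenerated] (hl : l.ker = ∅) :
    ∃ c : ι → ℕ, Tendsto c l atTop := by
  classical
  obtain ⟨B, hB⟩ := l.exists_antitone_basis
  have hescape (i : ι) : ∃ k, i ∉ B k := by
    by_contra! h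
    have : i ∈ l.ker := mem_ker.2 fun s hs => let ⟨k, hk⟩ := hB.mem_iff.1 hs; hk (h k)
    simp [hl] at this
  refine ⟨fun i => Nat.find (hescape i), tendsto_atTop.2 fun k => ?_⟩
  filter_upwards [hB.mem k] with i hi
  exact (Nat.le_find_iff _ _).2 fun j hj h => h (hB.antitone hj.le hi)

theorem exists_tendsto_diagonal [(𝓝 a).IsCountablyGenerated] [l.IsCountablyGenerated]
    (hl : l.ker = ∅) {F : ℕ → ι → X} {A : ℕ → X} (hF : ∀ n, Tendsto (F n) l (𝓝 (A n)))
    (hA : Tendsto A atTop (𝓝 a)) : ∃ N : ι → ℕ, Tendsto (fun i => F (N i) i) l (𝓝 a) := by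
  classical
  obtain ⟨c, hc⟩ := exists_tendsto_nat_atTop hl
  obtain ⟨U, hU⟩ := (𝓝 a).exists_antitone_basis
  have hsel (k : ℕ) : ∃ n, ∀ᶠ i in l, F n i ∈ U k := by
    obtain ⟨n, hn⟩ := (hA.eventually (eventually_mem_nhds_iff.2 (hU.mem k))).exists
    exact ⟨n, hF n hn⟩
  choose n hn using hsel
  set K : ι → ℕ := fun i => Nat.findGreatest (fun k => F (n k) i ∈ U k) (c i)
  refine ⟨fun i => n (K i), hU.tendsto_right_iff.2 fun k _ => ?_⟩
  filter_upwards [hn k, hc.eventually_ge_atTop k] with i hi hki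
  exact hU.antitone (Nat.le_findGreatest hki hi)
    (Nat.findGreatest_spec (P := fun k => F (n k) i ∈ U k) hki hi)

end Diagonal

theorem tendsto_eLpNorm_one_of_abs_le {α ι : Type*} [MeasurableSpace α] {μ : Measure α}
    [IsFiniteMeasure μ] {l : Filter ι} [l.IsCountablyGenerated] {f : ι → α → ℝ} {g : α → ℝ}
    (hf : ∀ i, AEStronglyMeasurable (f i) μ) {C : ℝ} (hC : ∀ᶠ i in l, ∀ᵐ x ∂μ, |f i x| ≤ C)
    (hlim : ∀ᵐ x ∂μ, Tendsto (fun i => f i x) l (𝓝 (g x))) :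
    Tendsto (fun i => eLpNorm (f i) 1 μ) l (𝓝 (eLpNorm g 1 μ)) := by
  simp only [eLpNorm_one_eq_lintegral_enorm]
  refine tendsto_lintegral_filter_of_dominated_convergence' (fun _ => ENNReal.ofReal C)
    (Eventually.of_forall fun i => (hf i).enorm) ?_ (by simp [ENNReal.mul_eq_top])
    (hlim.mono fun x hx => hx.enorm)
  filter_upwards [hC] with i hi
  filter_upwards [hi] with x hx
  exact (Real.enorm_eq_ofReal_abs (f i x)).trans_le (ENNReal.ofReal_le_ofReal hx)

section RecoveryData

/-- `u` is a nonnegative `C¹` function on `[0, T] × [-κ, κ]`. -/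
def IsAdmissible (κ T : ℝ) (u : ℝ → ℝ → ℝ) : Prop :=
  ContDiffOn ℝ 1 (Function.uncurry u) (Icc 0 T ×ˢ Icc (-κ) κ) ∧
    ∀ t ∈ Icc 0 T, ∀ s ∈ Icc (-κ) κ, 0 ≤ u t s

/-- The quantities whose limits characterise a recovery sequence for `(um, up)`: the errors of the
boundary values, the energies at times `0` and `T`, and the dissipation. They form one point of a
product space so that a diagonal sequence can be chosen for all of them at once. -/
noncomputable def recoveryData (κ T : ℝ) (γ : Measure ℝ) (um up : ℝ → ℝ) (u : ℝ → ℝ → ℝ) :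
    ℝ≥0∞ × ℝ≥0∞ × ℝ × ℝ × ℝ≥0∞ :=
  (eLpNorm (fun t => u t (-κ) - um t) 1 (volume.restrict (Icc 0 T)),
    eLpNorm (fun t => u t κ - up t) 1 (volume.restrict (Icc 0 T)),
    energy γ (u 0), energy γ (u T), dissipation κ T γ u)

/-- The limit of `recoveryData` along the centered profiles with coefficients `(m, b, ρ)`, as the
measure concentrates at `±κ`. -/
noncomputable def profileData (κ T m : ℝ) (b ρ um up : ℝ → ℝ) : ℝ≥0∞ × ℝ≥0∞ × ℝ × ℝ × ℝ≥0∞ :=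
  (eLpNorm (fun t => profile κ m (b t) (ρ t) (-κ) - um t) 1 (volume.restrict (Icc 0 T)),
    eLpNorm (fun t => profile κ m (b t) (ρ t) κ - up t) 1 (volume.restrict (Icc 0 T)),
    energyZero (m - b 0) (m + b 0), energyZero (m - b T) (m + b T),
    ∫⁻ t in Icc 0 T, profileCost κ m (deriv b t / 2) (b t) (ρ t))

variable {ι : Type*} {l : Filter ι} [l.IsCountablyGenerated] {γ : ι → Measure ℝ}
  {κ T m : ℝ} {b ρ um up : ℝ → ℝ}

theorem IsConcentrating.tendsto_eLpNorm_centeredProfile_sub (h : IsConcentrating κ γ l)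
    (hb : Continuous b) (hρ : Continuous ρ) {v : ℝ → ℝ} (hv : ContinuousOn v (Icc 0 T)) {s : ℝ}
    (hs : s ∈ Icc (-κ) κ) :
    Tendsto (fun i => eLpNorm (fun t => centeredProfile κ m (b t) (ρ t) (γ i) s - v t) 1
        (volume.restrict (Icc 0 T))) l
      (𝓝 (eLpNorm (fun t => profile κ m (b t) (ρ t) s - v t) 1 (volume.restrict (Icc 0 T)))) := by
  have hdom : ContinuousOn (fun t => |m - v t| + 2 * (|b t| + |ρ t|)) (Icc 0 T) := by fun_prop
  obtain ⟨C, hC⟩ := isCompact_Icc.exists_bound_of_continuousOn hdom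
  refine tendsto_eLpNorm_one_of_abs_le (C := C) (fun i => ?_) (Eventually.of_forall fun i => ?_)
    (Eventually.of_forall fun t => (h.tendsto_centeredProfile m (b t) (ρ t) s).sub_const (v t))
  · exact (((continuous_centeredProfile hb hρ).comp (Continuous.prodMk_left s)).continuousOn.sub
      hv).aestronglyMeasurable measurableSet_Icc
  · have := h.isProbabilityMeasure i
    filter_upwards [ae_restrict_mem measurableSet_Icc] with t ht
    have hsplit : centeredProfile κ m (b t) (ρ t) (γ i) s - v t
        = m - v t + centeredProfile κ 0 (b t) (ρ t) (γ i) s := by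
      simp only [centeredProfile, profile]
      ring
    rw [hsplit]
    exact (abs_add_le _ _).trans ((add_le_add_right
      (abs_centeredProfile_zero_le (h.ae_mem i) _ _ hs) _).trans ((le_abs_self _).trans (hC t ht)))

theorem IsConcentrating.tendsto_recoveryData (h : IsConcentrating κ γ l) (hκ : 0 < κ)
    (hT : 0 ≤ T) (hb : ContDiff ℝ 1 b) (hρ : ContDiff ℝ 1 ρ) {δ : ℝ} (hδ : 0 < δ)
    (hlow : ∀ t ∈ Icc 0 T, ∀ s ∈ Icc (-κ) κ, δ ≤ profile κ m (b t) (ρ t) s)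
    (hum : ContinuousOn um (Icc 0 T)) (hup : ContinuousOn up (Icc 0 T)) :
    Tendsto (fun i => recoveryData κ T (γ i) um up
        fun t => centeredProfile κ m (b t) (ρ t) (γ i)) l
      (𝓝 (profileData κ T m b ρ um up)) :=
  (h.tendsto_eLpNorm_centeredProfile_sub hb.continuous hρ.continuous hum
      (left_mem_Icc.2 (neg_le_self hκ.le))).prodMk_nhds <|
    (h.tendsto_eLpNorm_centeredProfile_sub hb.continuous hρ.continuous hup
      (right_mem_Icc.2 (neg_le_self hκ.le))).prodMk_nhds <|
    (h.tendsto_energy_centeredProfile hκ m (b 0) (ρ 0)).prodMk_nhds <|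
    (h.tendsto_energy_centeredProfile hκ m (b T) (ρ T)).prodMk_nhds <|
    h.tendsto_dissipation_centeredProfile hT hb hρ hδ hlow

theorem IsConcentrating.exists_tendsto_recoveryData (h : IsConcentrating κ γ l) (hκ : 0 < κ)
    (hT : 0 ≤ T) (hb : ContDiff ℝ 1 b) (hρ : ContDiff ℝ 1 ρ) {δ : ℝ} (hδ : 0 < δ)
    (hlow : ∀ t ∈ Icc 0 T, ∀ s ∈ Icc (-κ) κ, δ ≤ profile κ m (b t) (ρ t) s)
    (hum : ContinuousOn um (Icc 0 T)) (hup : ContinuousOn up (Icc 0 T)) :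
    ∃ u : ι → ℝ → ℝ → ℝ, (∀ i, IsAdmissible κ T (u i)) ∧
      Tendsto (fun i => recoveryData κ T (γ i) um up (u i)) l
        (𝓝 (profileData κ T m b ρ um up)) := by
  classical
  set v : ι → ℝ → ℝ → ℝ := fun i t => centeredProfile κ m (b t) (ρ t) (γ i)
  refine ⟨fun i => if IsAdmissible κ T (v i) then v i else 0, fun i => ?_, ?_⟩
  · simp only
    split_ifs with hv
    · exact hv
    · exact ⟨contDiffOn_const, fun _ _ _ _ => le_rfl⟩
  · refine (h.tendsto_recoveryData hκ hT hb hρ hδ hlow hum hup).congr' ?_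
    filter_upwards [h.eventually_forall_le_centeredProfile hb.continuous hρ.continuous hδ hlow]
      with i hi
    rw [if_pos ⟨(contDiff_centeredProfile hb hρ).contDiffOn, hi⟩]

end RecoveryData

section Approximation

variable {κ T m : ℝ} {b β um up : ℝ → ℝ} {φ : ℕ → ContDiffBump (0 : ℝ)}

theorem exists_contDiffBump_rOut_tendsto_zero : ∃ φ : ℕ → ContDiffBump (0 : ℝ),
    Tendsto (fun n => (φ n).rOut) atTop (𝓝 0) ∧ ∀ n, (φ n).rOut ≤ 2 * (φ n).rIn :=
  ⟨fun n => ⟨1 / ((n : ℝ) + 1) / 2, 1 / ((n : ℝ) + 1), half_pos Nat.one_div_pos_of_nat,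
    half_lt_self Nat.one_div_pos_of_nat⟩, tendsto_one_div_add_atTop_nhds_zero_nat,
    fun _ => (mul_div_cancel₀ _ two_ne_zero).ge⟩

theorem continuous_energyZero : Continuous fun p : ℝ × ℝ => energyZero p.1 p.2 := by
  have hlog {f : ℝ × ℝ → ℝ} (hf : Continuous f) : Continuous fun p => f p * Real.log (f p) :=
    Real.continuous_mul_log.comp hf
  exact (((hlog continuous_snd).add (hlog continuous_fst)).div_const 2).sub (hlog (by fun_prop))

theorem tendsto_energyZero {ι : Type*} {l : Filter ι} {f g : ι → ℝ} {x y : ℝ}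
    (hf : Tendsto f l (𝓝 x)) (hg : Tendsto g l (𝓝 y)) :
    Tendsto (fun i => energyZero (f i) (g i)) l (𝓝 (energyZero x y)) :=
  (continuous_energyZero.tendsto (x, y)).comp (hf.prodMk_nhds hg)

theorem tendsto_energyZero_mollify (hφ : Tendsto (fun n => (φ n).rOut) atTop (𝓝 0))
    (hb : Continuous b) (m t : ℝ) :
    Tendsto (fun n => energyZero (m + (φ n).rOut - mollify (φ n) b t)
      (m + (φ n).rOut + mollify (φ n) b t)) atTop (𝓝 (energyZero (m - b t) (m + b t))) := by
  have hm : Tendsto (fun n => m + (φ n).rOut) atTop (𝓝 m) := by simpa using hφ.const_add m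
  have hbt := tendsto_mollify hφ hb t
  exact tendsto_energyZero (hm.sub hbt) (hm.add hbt)

theorem tendsto_eLpNorm_mollify_sub {μ : Measure ℝ} [IsFiniteMeasure μ]
    (hφ : Tendsto (fun n => (φ n).rOut) atTop (𝓝 0)) (hb : Continuous b) {C : ℝ}
    (hC : ∀ t, |b t| ≤ C) (σ : ℝ) :
    Tendsto (fun n => eLpNorm (fun t => (φ n).rOut + σ * (mollify (φ n) b t - b t)) 1 μ) atTop
      (𝓝 0) := by
  have hmol (n : ℕ) : Continuous (mollify (φ n) b) :=
    (contDiff_mollify (φ n) hb.locallyIntegrable).continuous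
  rw [show 𝓝 (0 : ℝ≥0∞) = 𝓝 (eLpNorm (fun _ : ℝ => (0 : ℝ)) 1 μ) by simp]
  refine tendsto_eLpNorm_one_of_abs_le (C := 1 + |σ| * (C + C))
    (fun n => Continuous.aestronglyMeasurable (by fun_prop)) ?_ (Eventually.of_forall fun t => ?_)
  · filter_upwards [hφ.eventually_le_const one_pos] with n hn
    refine Eventually.of_forall fun t => (abs_add_le _ _).trans (add_le_add ?_ ?_)
    · rwa [abs_of_pos (φ n).rOut_pos]
    · rw [abs_mul]
      gcongr
      exact (abs_sub _ _).trans (add_le_add (abs_mollify_le (φ n) hC t) (hC t))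
  · simpa using hφ.add (((tendsto_mollify hφ hb t).sub_const (b t)).const_mul σ)

theorem IsPath.tendsto_profileData (h : IsPath T m b β) (hκ : 0 < κ) (hT : 0 ≤ T)
    (hval : ∀ t ∈ Icc 0 T, um t = m - b t ∧ up t = m + b t)
    (hφ : Tendsto (fun n => (φ n).rOut) atTop (𝓝 0))
    (hφK : ∀ n, (φ n).rOut ≤ 2 * (φ n).rIn) :
    Tendsto (fun n => profileData κ T (m + (φ n).rOut) (mollify (φ n) b)
        (mollify (φ n) (pathCoeff κ m b β)) um up) atTop
      (𝓝 (0, 0, energyZero (um 0) (up 0), energyZero (um T) (up T),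
        ∫⁻ t in Icc 0 T, optCost κ (β t / 2) (m - b t) (m + b t))) := by
  have hbdry (σ : ℝ) := tendsto_eLpNorm_mollify_sub (μ := volume.restrict (Icc 0 T)) hφ
    h.continuous h.bound σ
  have h0 := hval 0 ⟨le_rfl, hT⟩
  have hend := hval T ⟨hT, le_rfl⟩
  rw [h0.1, h0.2, hend.1, hend.2]
  refine ((hbdry (-1)).congr fun n => ?_).prodMk_nhds <|
    ((hbdry 1).congr fun n => ?_).prodMk_nhds <|
    (tendsto_energyZero_mollify hφ h.continuous m 0).prodMk_nhds <|
    (tendsto_energyZero_mollify hφ h.continuous m T).prodMk_nhds <|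
    h.tendsto_lintegral_profileCost hκ hφ (Eventually.of_forall hφK)
  all_goals
    refine eLpNorm_congr_ae ((ae_restrict_mem measurableSet_Icc).mono fun t ht => ?_)
    simp only [profile_left hκ, profile_right hκ, hval t ht]
    ring

end Approximation

theorem continuousOn_of_limitDissipation_lt_top {κ T : ℝ} (hT : 0 ≤ T) {um up : ℝ → ℝ}
    (hJ : limitDissipation κ T um up < ⊤) :
    ContinuousOn um (Icc 0 T) ∧ ContinuousOn up (Icc 0 T) := by
  rw [limitDissipation] at hJ
  split_ifs at hJ with hcond
  · rw [← uIcc_of_le hT]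
    exact ⟨hcond.1.continuousOn, hcond.2.1.continuousOn⟩
  · exact absurd hJ (lt_irrefl _)

theorem mainTheorem4_general {ι : Type*} {l : Filter ι} [l.IsCountablyGenerated] (hl : l.ker = ∅)
    {κ : ℝ} (hκ : 0 < κ) {γ : ι → Measure ℝ} (hγ : IsConcentrating κ γ l) {T : ℝ} (hT : 0 ≤ T)
    {um up : ℝ → ℝ} (hJ : limitDissipation κ T um up < ⊤) :
    ∃ u : ι → ℝ → ℝ → ℝ, (∀ i, IsAdmissible κ T (u i)) ∧
      Tendsto (fun i => eLpNorm (fun t => u i t (-κ) - um t) 1 (volume.restrict (Icc 0 T))) l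
        (𝓝 0) ∧
      Tendsto (fun i => eLpNorm (fun t => u i t κ - up t) 1 (volume.restrict (Icc 0 T))) l
        (𝓝 0) ∧
      Tendsto (fun i => energy (γ i) (u i 0)) l (𝓝 (energyZero (um 0) (up 0))) ∧
      Tendsto (fun i => energy (γ i) (u i T)) l (𝓝 (energyZero (um T) (up T))) ∧
      Tendsto (fun i => dissipation κ T (γ i) (u i)) l (𝓝 (limitDissipation κ T um up)) := by
  obtain ⟨m, b, β, hpath, hval, hlimit⟩ := exists_isPath hκ hT hJ
  obtain ⟨hum, hup⟩ := continuousOn_of_limitDissipation_lt_top hT hJ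
  obtain ⟨φ, hφ, hφK⟩ := exists_contDiffBump_rOut_tendsto_zero
  have hstage (n : ℕ) := hγ.exists_tendsto_recoveryData hκ hT
    (contDiff_mollify (φ n) hpath.continuous.locallyIntegrable)
    (contDiff_mollify (φ n) (hpath.locallyIntegrable_pathCoeff hκ.le)) (φ n).rOut_pos
    (fun t _ s hs => hpath.rOut_le_profile_mollify hκ (φ n) t hs) hum hup
  choose v hv hvlim using hstage
  obtain ⟨N, hN⟩ := exists_tendsto_diagonal hl hvlim
    (hpath.tendsto_profileData hκ hT hval hφ hφK)
  rw [← hlimit] at hN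
  simp only [recoveryData, nhds_prod_eq, tendsto_prod_iff'] at hN
  exact ⟨fun i => v (N i) i, fun i => hv (N i) i, hN⟩

end Kramers

theorem mainTheorem4 (H : ℝ → ℝ) (hH : Kramers.IsDoubleWell H) (T : ℝ) (hT : 0 < T)
    (um up : ℝ → ℝ)
    (hum : AbsolutelyContinuousOnInterval um 0 T)
    (hup : AbsolutelyContinuousOnInterval up 0 T)
    (hJ : Kramers.dissipationZero H T um up < (⊤ : ℝ≥0∞)) :
    ∃ u : ℝ → ℝ → ℝ → ℝ,
      (∀ ε : ℝ, 0 < ε →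
        ContDiffOn ℝ 1 (Function.uncurry (u ε))
          (Icc 0 T ×ˢ Icc (-Kramers.kappa H) (Kramers.kappa H)) ∧
        ∀ t ∈ Icc 0 T, ∀ s ∈ Icc (-Kramers.kappa H) (Kramers.kappa H), 0 ≤ u ε t s) ∧
      Tendsto (fun ε => eLpNorm (fun t => u ε t (-Kramers.kappa H) - um t) 1
        (volume.restrict (Icc 0 T))) (𝓝[>] 0) (𝓝 0) ∧
      Tendsto (fun ε => eLpNorm (fun t => u ε t (Kramers.kappa H) - up t) 1
        (volume.restrict (Icc 0 T))) (𝓝[>] 0) (𝓝 0) ∧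
      Tendsto (fun ε => Kramers.energyHat H ε (u ε 0)) (𝓝[>] 0)
        (𝓝 (Kramers.energyZero (um 0) (up 0))) ∧
      Tendsto (fun ε => Kramers.energyHat H ε (u ε T)) (𝓝[>] 0)
        (𝓝 (Kramers.energyZero (um T) (up T))) ∧
      Tendsto (fun ε => Kramers.dissipationHat H T ε (u ε)) (𝓝[>] 0)
        (𝓝 (Kramers.dissipationZero H T um up)) := by
  obtain ⟨u, hu, hlim⟩ := Kramers.mainTheorem4_general (l := 𝓝[>] 0) (by simp [nhdsWithin])
    hH.kappa_pos hH.isConcentrating_gammaHat hT.le hJ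
  exact ⟨u, fun ε _ => hu ε, hlim⟩
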